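/- Let $k\ge 1$, $d\ge 1$, let $P=(p_1,\dots,p_n)$ be points in $\mathbb{R}^d$ (repetitions allowed), and let $L,U$ be integers with $1\le L\le\lfloor n/k\rfloor\le\lceil n/k\rceil\le U\le n$. A balanced $k$-center clustering of radius $r$ is a partition of $P$ into $k$ clusters, each with at least $L$ and at most $U$ points, together with $k$ centers in $\mathbb{R}^d$, such that every point is within Euclidean distance $r$ of the center of its cluster; $r^*$ denotes the infimum of the radii $r$ of all balanced $k$-center clusterings of $P$. Consider the following algorithm. (1) Gonzalez's algorithm: starting from an arbitrary point $s_1$ of $P$, select $s_2,\dots,s_k$ from $P$ one after the other, each $s_j$ at largest minimum distance to $s_1,\dots,s_{j-1}$; let $S=\{s_1,\dots,s_k\}$. (2) Compute the $nk$ distances between $P$ and $S$ and sort them. (3) For each $k$-tuple in $S^k$, binary search the sorted list, where a radius $r$ is tested as follows: draw the closed balls $B_1,\dots,B_k$ of radius $r$ around the entries of the tuple; for each $T\subseteq\{1,\dots,k\}$ count the number $n_T$ of points that lie in exactly the balls $B_j$, $j\in T$; and decide whether the linear system $$\sum_{j\in T}x_T^j=n_T\ \ \text{for all } T,\qquad L\le\sum_{T\ni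 j}x_T^j\le U\ \ \text{for all } j,\qquad x_T^j\ge 0\ \ (j\in T)$$ has a rational solution. If it has, record $r$, the tuple and a solution, provided that nothing has been recorded yet or $r$ is smaller than the recorded radius, and continue with the smaller radii; otherwise continue with the larger radii. (4) Round the recorded solution to an integral one, by adjusting its fractional values along cycles and leaf-to-leaf paths, send $x_T^j$ of the points that lie in exactly the balls indexed by $T$ to cluster $j$, and return this clustering, the recorded tuple as its centers, and the recorded radius. For every input as above and every choice of $s_1$, the algorithm returns a balanced $k$-center clustering of $P$ of a radius at most $4r^*$. For every fixed $k$ there is a constant $C_k$, depending only on $k$, such that the algorithm performs at most $C_k\,n(\log n+d)$ steps on every such input, where an elementary operation on numbers (arithmetic, square root, rounding, comparison), on $k$-bit words, or on memory cells and lists is one step. -/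

import Mathlib

noncomputable section

namespace BalancedKCenter

/-! ### The problem -/

/-- `a` assigns the `n` points of `P` (repetitions allowed) to `k` clusters with centers `c` anywhere
in `ℝ^d`, every cluster has between `L` and `U` points, and cluster `j` lies in the closed ball of
radius `r` around `c j`. -/
def IsBalancedClustering {n d k : ℕ} (P : Fin n → EuclideanSpace ℝ (Fin d)) (L U : ℕ)
    (a : Fin n → Fin k) (c : Fin k → EuclideanSpace ℝ (Fin d)) (r : ℝ) : Prop :=
  (∀ j, L ≤ (Finset.univ.filter fun i => a i = j).card ∧
    (Finset.univ.filter fun i => a i = j).card ≤ U) ∧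
  ∀ i, dist (P i) (c (a i)) ≤ r

/-- The optimal radius of balanced `k`-center clustering. -/
def optRadius {n d : ℕ} (k : ℕ) (P : Fin n → EuclideanSpace ℝ (Fin d)) (L U : ℕ) : ℝ :=
  sInf {r | ∃ (a : Fin n → Fin k) (c : Fin k → EuclideanSpace ℝ (Fin d)),
    IsBalancedClustering P L U a c r}

/-! ### Step-counted computations

Unit-cost real RAM: an elementary operation (arithmetic, square root, rounding, comparison, reading
or writing one memory cell, adding an element to the front of a list) costs one step.  Sets of
clusters are words of `k` bits, on which the elementary operations also cost one step. -/

/-- The result of a computation together with the number of steps it took. -/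
structure Timed (α : Type) where
  val : α
  time : ℕ

instance : Monad Timed where
  pure a := ⟨a, 0⟩
  bind x f := ⟨(f x.val).val, x.time + (f x.val).time⟩

/-- The value of an expression that is evaluated by at most `c` elementary operations. -/
def ops {α : Type} (c : ℕ) (a : α) : Timed α := ⟨a, c⟩

/-- One step. -/
def tick : Timed Unit := ops 1 ()

/-- Allocates an array indexed by `ι` and fills every cell `i` with the result of `f i`.  (A later
write to one cell is `Function.update`, one step; the old array is never used again after a
write.) -/
def tabulate {ι α : Type} [Fintype ι] (f : ι → Timed α) : Timed (ι → α) :=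
  ⟨fun i => (f i).val, ∑ i, ((f i).time + 1)⟩

/-- The loop `for a in l do b := f a b`. -/
def forEach {α β : Type} : List α → β → (α → β → Timed β) → Timed β
  | [], b, _ => pure b
  | a :: l, b, f => do
    tick
    let b' ← f a b
    forEach l b' f

/-- The first element of a list that passes the test `p`. -/
def findFirst {α : Type} (p : α → Timed Bool) : List α → Timed (Option α)
  | [] => ops 1 none
  | a :: l => do
    tick
    let b ← p a
    if b then ops 1 (some a) else findFirst p l

/-- The entry number `i` of a linked list. -/
def nth : List ℝ → ℕ → Timed ℝ
  | [], _ => ops 1 0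
  | a :: _, 0 => ops 1 a
  | _ :: l, i + 1 => do
    tick
    nth l i

/-! ### Distances, Gonzalez's algorithm, sorting -/

/-- The Euclidean distance, computed coordinate by coordinate. -/
def distance {d : ℕ} (p q : EuclideanSpace ℝ (Fin d)) : Timed ℝ := do
  let s ← forEach (List.finRange d) 0 fun c acc =>
    ops 8 (acc + (p c - q c) * (p c - q c))
  ops 1 (Real.sqrt s)

/-- An index at which `m` is largest. -/
def argmax {n : ℕ} (m : Fin n → ℝ) (i₀ : Fin n) : Timed (Fin n) :=
  forEach (List.finRange n) i₀ fun i b => ops 4 (if m b < m i then i else b)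

/-- Gonzalez's algorithm, started at the point `i₀`; it maintains the distance of every point to the
nearest selected one. -/
def gonzalez {n d : ℕ} (k : ℕ) (P : Fin n → EuclideanSpace ℝ (Fin d)) (i₀ : Fin n) :
    Timed (Fin k → Fin n) := do
  let s₀ ← tabulate fun _ : Fin k => ops 1 i₀
  let m₀ ← tabulate fun a => distance (P a) (P i₀)
  let st ← forEach (List.finRange k).tail (s₀, m₀) fun j st => do
    let i ← argmax st.2 i₀
    let s ← ops 1 (Function.update st.1 j i)
    let m ← tabulate fun a => do
      let x ← distance (P a) (P i)
      ops 3 (min (st.2 a) x)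
    pure (s, m)
  pure st.1

/-- Splits a list into two halves. -/
def split : List ℝ → Timed (List ℝ × List ℝ)
  | [] => ops 1 ([], [])
  | a :: l => do
    let r ← split l
    ops 3 (a :: r.2, r.1)

/-- Merges two increasing lists. -/
def merge : List ℝ → List ℝ → Timed (List ℝ)
  | [], l => ops 1 l
  | a :: l, [] => ops 1 (a :: l)
  | a :: l, b :: l' => do
    let c ← ops 3 (decide (a ≤ b))
    if c then do
      let r ← merge l (b :: l')
      ops 1 (a :: r)
    else do
      let r ← merge (a :: l) l'
      ops 1 (b :: r)
termination_by l l' => l.length + l'.length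

/-- Merge sort; the first argument only bounds the recursion depth. -/
def sort : ℕ → List ℝ → Timed (List ℝ)
  | f + 1, a :: b :: l => do
    let h ← split (a :: b :: l)
    let x ← sort f h.1
    let y ← sort f h.2
    merge x y
  | _, l => ops 1 l

/-- All tuples of length `m` with entries in `{1, …, k}`. -/
def tuples (k : ℕ) : (m : ℕ) → Timed (List (Fin m → Fin k))
  | 0 => ops 1 [Fin.elim0]
  | m + 1 => do
    let ts ← tuples k m
    forEach (List.finRange k) [] fun j acc =>
      forEach ts acc fun t acc' => do
        let t' ← tabulate fun i => ops 1 ((Fin.cons j t : Fin (m + 1) → Fin k) i)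
        ops 1 (t' :: acc')

/-! ### The system of linear constraints -/

/-- A set of balls, standing for the region of the points that lie in exactly these balls. -/
abbrev Region (k : ℕ) : Type := Finset (Fin k)

/-- The variable `(T, j)` is the number of points of region `T` that go to cluster `j`. -/
abbrev Var (k : ℕ) : Type := Region k × Fin k

/-- The regions, in the order of a loop through all of them. -/
def regions (k : ℕ) : List (Region k) := (List.finRange k).sublists.map List.toFinset

/-- The variables, in the order of a loop through all of them. -/
def vars (k : ℕ) : List (Var k) := (regions k) ×ˢ (List.finRange k)

/-- The region of point `i` for the balls of radius `r` around the tuple `t`, from the table `D` of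
the distances between the points and the candidates. -/
def regionOf {n k : ℕ} (D : Fin n → Fin k → ℝ) (t : Fin k → Fin k) (r : ℝ) (i : Fin n) :
    Timed (Region k) :=
  forEach (List.finRange k) ∅ fun j T => ops 5 (if D i (t j) ≤ r then insert j T else T)

/-- The number of points in region `T`. -/
def countIn {n k : ℕ} (reg : Fin n → Region k) (T : Region k) : Timed ℕ :=
  forEach (List.finRange n) 0 fun i c => ops 3 (if reg i = T then c + 1 else c)

/-- The linear constraint `∑ v, coef v * x v = rhs` (if `isEq`) or `∑ v, coef v * x v ≤ rhs`. -/
structure Constraint (k : ℕ) where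
  isEq : Bool
  coef : Var k → ℚ
  rhs : ℚ

/-- The constraint `s * (sum of the variables in p) = b`, or `≤ b`. -/
def row {k : ℕ} (isEq : Bool) (p : Var k → Prop) [DecidablePred p] (s b : ℚ) :
    Timed (Constraint k) := do
  let c ← tabulate fun v => ops 3 (if p v then s else 0)
  ops 1 ⟨isEq, c, b⟩

/-- The system: in every region the variables add up to the number of its points, every cluster gets
between `L` and `U` points, all variables are non-negative, and `(T, j)` is zero unless `j ∈ T` (so
that the system is infeasible if some point lies in no ball). -/
def system {k : ℕ} (cnt : Region k → ℕ) (L U : ℕ) : Timed (List (Constraint k)) := do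
  let cs ← forEach (regions k) [] fun T acc => do
    let a ← row true (fun v => v.1 = T) 1 (cnt T)
    ops 2 (a :: acc)
  let cs' ← forEach (List.finRange k) cs fun j acc => do
    let a ← row false (fun v => v.2 = j) 1 U
    let b ← row false (fun v => v.2 = j) (-1) (-L)
    ops 3 (a :: b :: acc)
  forEach (vars k) cs' fun v acc => do
    let a ← if v.2 ∈ v.1 then row false (fun w => w = v) (-1) 0
      else row true (fun w => w = v) 1 0
    ops 2 (a :: acc)

/-! ### Solving the system: Gaussian elimination, extended to inequalities -/

/-- `c` minus the multiple of the equation `e` that cancels the variable `v`. -/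
def substitute {k : ℕ} (v : Var k) (e c : Constraint k) : Timed (Constraint k) := do
  let m ← ops 3 (c.coef v / e.coef v)
  let a ← tabulate fun w => ops 4 (c.coef w - m * e.coef w)
  ops 6 ⟨c.isEq, a, c.rhs - m * e.rhs⟩

/-- The non-negative combination of the inequalities `p` (where `v` has a positive coefficient) and
`q` (where it has a negative one) in which `v` cancels. -/
def combine {k : ℕ} (v : Var k) (p q : Constraint k) : Timed (Constraint k) := do
  let c ← tabulate fun w => ops 8 (-(q.coef v) * p.coef w + p.coef v * q.coef w)
  ops 9 ⟨false, c, -(q.coef v) * p.rhs + p.coef v * q.rhs⟩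

/-- The constraints of a list that pass a sign test for the coefficient of `v`. -/
def select {k : ℕ} (v : Var k) (p : ℚ → Prop) [DecidablePred p] (cs : List (Constraint k)) :
    Timed (List (Constraint k)) :=
  forEach cs [] fun c acc => ops 3 (if p (c.coef v) then c :: acc else acc)

/-- Eliminates `v`, which occurs in no equation, from a system. -/
def eliminate {k : ℕ} (v : Var k) (cs : List (Constraint k)) : Timed (List (Constraint k)) := do
  let pos ← select v (fun q => 0 < q) cs
  let neg ← select v (fun q => q < 0) cs
  let zero ← select v (fun q => q = 0) cs
  forEach pos zero fun p acc =>
    forEach neg acc fun q acc' => do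
      let c ← combine v p q
      ops 1 (c :: acc')

/-- The value of `v` at which `c` holds with equality when the other variables have the values
`x`. -/
def bound {k : ℕ} (v : Var k) (x : Var k → ℚ) (c : Constraint k) : Timed ℚ := do
  let s ← forEach (vars k) c.rhs fun w acc =>
    ops 6 (if w = v then acc else acc - c.coef w * x w)
  ops 2 (s / c.coef v)

/-- A value for `v`, which occurs in no equation, that satisfies `cs` when the other variables have
the values `x`: the largest lower bound, if there is none the smallest upper bound, if there is none
zero. -/
def chooseValue {k : ℕ} (v : Var k) (cs : List (Constraint k)) (x : Var k → ℚ) : Timed ℚ := do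
  let neg ← select v (fun q => q < 0) cs
  let lower ← forEach neg none fun c acc => do
    let b ← bound v x c
    ops 2 (some (acc.elim b (max b)))
  match lower with
  | some b => ops 1 b
  | none => do
    let pos ← select v (fun q => 0 < q) cs
    let upper ← forEach pos none fun c acc => do
      let b ← bound v x c
      ops 2 (some (acc.elim b (min b)))
    ops 2 (upper.getD 0)

/-- Solves a system in the listed variables: eliminate the first one, by means of an equation if one
contains it, solve the rest, substitute back.  `none` means infeasible. -/
def solve {k : ℕ} : List (Var k) → List (Constraint k) → Timed (Option (Var k → ℚ))
  | [], cs => do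
    let ok ← forEach cs true fun c acc =>
      ops 5 (acc && (if c.isEq then decide (c.rhs = 0) else decide (0 ≤ c.rhs)))
    let x ← tabulate fun _ : Var k => ops 1 0
    ops 1 (if ok then some x else none)
  | v :: vs, cs => do
    let e? ← findFirst (fun c => ops 4 (c.isEq && decide (c.coef v ≠ 0))) cs
    match e? with
    | some e => do
      let cs' ← forEach cs [] fun c acc => do
        let c' ← substitute v e c
        ops 1 (c' :: acc)
      let s ← solve vs cs'
      match s with
      | none => ops 1 none
      | some x => do
        let y ← bound v x e
        ops 1 (some (Function.update x v y))
    | none => do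
      let cs' ← eliminate v cs
      let s ← solve vs cs'
      match s with
      | none => ops 1 none
      | some x => do
        let y ← chooseValue v cs x
        ops 1 (some (Function.update x v y))

/-! ### Rounding a solution -/

/-- Whether the value of the variable `(T, j)` is fractional. -/
def isFrac {k : ℕ} (x : Var k → ℚ) (T : Region k) (j : Fin k) : Timed Bool :=
  ops 3 (decide (x (T, j) ≠ ⌊x (T, j)⌋))

/-- The number of regions in which ball `j` has a fractional value. -/
def fracDegree {k : ℕ} (x : Var k → ℚ) (j : Fin k) : Timed ℕ :=
  forEach (regions k) 0 fun T c => do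
    let b ← isFrac x T j
    ops 2 (if b then c + 1 else c)

/-- An edge of the coloured multigraph on the balls: both `(region, src)` and `(region, dst)` are
fractional; the region is the colour. -/
structure Edge (k : ℕ) where
  src : Fin k
  region : Region k
  dst : Fin k

/-- The part of a trail (latest edge first) from its end back to the edge that leaves `j`. -/
def cut {k : ℕ} (j : Fin k) : List (Edge k) → Timed (List (Edge k))
  | [] => ops 1 []
  | e :: l => do
    let b ← ops 2 (decide (e.src = j))
    if b then ops 1 [e]
    else do
      let r ← cut j l
      ops 1 (e :: r)

/-- Extends a trail (latest edge first) that has arrived at ball `v`, never using the colour of the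
last edge again at once, until it closes a cycle, which is returned, or gets stuck in a leaf, when
the whole path is returned.  A colour that was met before leads back to the trail.  The first
argument only bounds the recursion depth. -/
def walk {k : ℕ} (x : Var k → ℚ) : ℕ → List (Edge k) → Fin k → Timed (List (Edge k))
  | 0, trail, _ => pure trail
  | f + 1, trail, v => do
    let T? ← findFirst (fun T => do
      let b ← isFrac x T v
      ops 4 (b && decide (trail.head?.map Edge.region ≠ some T))) (regions k)
    match T? with
    | none => ops 1 trail
    | some T => do
      let e? ← findFirst (fun e => ops 2 (decide (e.region = T))) trail
      let w? ← match e? with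
        | some e => ops 2 (some e.dst)
        | none => findFirst (fun w => do
            let b ← isFrac x T w
            ops 2 (b && decide (w ≠ v))) (List.finRange k)
      match w? with
      | none => ops 1 trail
      | some w => do
        let back ← findFirst (fun e => ops 2 (decide (e.src = w))) trail
        match back with
        | some _ => do
          let c ← cut w trail
          ops 2 (⟨v, T, w⟩ :: c)
        | none => do
          let trail' ← ops 2 (⟨v, T, w⟩ :: trail)
          walk x f trail' w

/-- Shifts the values along the edges by the largest amount that crosses no integer. -/
def adjust {k : ℕ} (x : Var k → ℚ) (es : List (Edge k)) : Timed (Var k → ℚ) := do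
  let δ ← forEach es 1 fun e acc =>
    ops 10 (min acc (min (x (e.region, e.src) - ⌊x (e.region, e.src)⌋)
      (⌈x (e.region, e.dst)⌉ - x (e.region, e.dst))))
  forEach es x fun e y => do
    let y' ← ops 4 (Function.update y (e.region, e.src) (y (e.region, e.src) - δ))
    ops 4 (Function.update y' (e.region, e.dst) (y' (e.region, e.dst) + δ))

/-- One adjustment along a cycle or a leaf-to-leaf path (nothing, if `x` is integral): the walk
starts in a leaf if there is one, otherwise in any ball that has a fractional value. -/
def roundStep {k : ℕ} (x : Var k → ℚ) : Timed (Var k → ℚ) := do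
  let leaf ← findFirst (fun j => do
    let c ← fracDegree x j
    ops 1 (decide (c = 1))) (List.finRange k)
  let start ← match leaf with
    | some j => ops 1 (some j)
    | none => findFirst (fun j => do
        let c ← fracDegree x j
        ops 1 (decide (0 < c))) (List.finRange k)
  match start with
  | none => ops 1 x
  | some j => do
    let es ← walk x (k + 1) [] j
    adjust x es

/-- Turns a solution of the system into an integral one: one adjustment per variable at most. -/
def roundSolution {k : ℕ} (x : Var k → ℚ) : Timed (Var k → ℚ) :=
  forEach (vars k) x fun _ y => roundStep y

/-- Distributes the points of every region to the clusters as the integral solution `x` says. -/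
def distribute {n k : ℕ} [NeZero k] (reg : Fin n → Region k) (x : Var k → ℚ) :
    Timed (Fin n → Fin k) := do
  let q₀ ← tabulate fun v : Var k => ops 2 ⌊x v⌋₊
  let a₀ ← tabulate fun _ : Fin n => ops 1 (0 : Fin k)
  let st ← forEach (List.finRange n) (q₀, a₀) fun i st => do
    let j? ← findFirst (fun j => ops 3 (decide (0 < st.1 (reg i, j)))) (List.finRange k)
    match j? with
    | none => ops 1 st
    | some j => ops 5 (Function.update st.1 (reg i, j) (st.1 (reg i, j) - 1),
        Function.update st.2 i j)
  pure st.2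

/-! ### The algorithm -/

/-- The regions of all points, for the balls of radius `r` around the tuple `t`. -/
def allRegions {n k : ℕ} (D : Fin n → Fin k → ℝ) (t : Fin k → Fin k) (r : ℝ) :
    Timed (Fin n → Region k) :=
  tabulate fun i => regionOf D t r i

/-- Builds the system for the balls of radius `r` around the tuple `t` and solves it. -/
def testRadius {n k : ℕ} (D : Fin n → Fin k → ℝ) (L U : ℕ) (t : Fin k → Fin k) (r : ℝ) :
    Timed (Option (Var k → ℚ)) := do
  let reg ← allRegions D t r
  let cnt ← tabulate fun T => countIn reg T
  let cs ← system cnt L U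
  solve (vars k) cs

/-- A recorded radius with its tuple and a solution of its system. -/
structure Record (k : ℕ) where
  radius : ℝ
  tuple : Fin k → Fin k
  sol : Var k → ℚ

/-- Records a feasible radius if it is smaller than the recorded one, or the first one. -/
def improve {k : ℕ} (best : Option (Record k)) (new : Record k) : Timed (Option (Record k)) :=
  match best with
  | none => ops 2 (some new)
  | some b => ops 4 (if new.radius < b.radius then some new else some b)

/-- Binary search for the tuple `t` between the positions `lo` and `hi - 1` of the increasing list
`R` of radii; the first argument only bounds the recursion depth. -/
def binarySearch {n k : ℕ} (D : Fin n → Fin k → ℝ) (L U : ℕ) (R : List ℝ) (t : Fin k → Fin k) :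
    ℕ → ℕ → ℕ → Option (Record k) → Timed (Option (Record k))
  | 0, _, _, best => ops 1 best
  | f + 1, lo, hi, best => do
    let empty ← ops 1 (decide (hi ≤ lo))
    if empty then ops 1 best
    else do
      let mid ← ops 2 ((lo + hi) / 2)
      let r ← nth R mid
      let s ← testRadius D L U t r
      match s with
      | none => do
        let lo' ← ops 1 (mid + 1)
        binarySearch D L U R t f lo' hi best
      | some x => do
        let best' ← improve best ⟨r, t, x⟩
        binarySearch D L U R t f lo mid best'

/-- What the algorithm returns: the cluster of every point, the centers (indices of input points),
and the radius. -/
structure Output (n k : ℕ) where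
  cluster : Fin n → Fin k
  center : Fin k → Fin n
  radius : ℝ

/-- The algorithm, started at the point `i₀`.  `none` would mean that no feasible solution was
recorded. -/
def algorithm {n d : ℕ} (k : ℕ) [NeZero k] (P : Fin n → EuclideanSpace ℝ (Fin d)) (L U : ℕ)
    (i₀ : Fin n) : Timed (Option (Output n k)) := do
  let s ← gonzalez k P i₀
  let D ← tabulate fun i : Fin n => tabulate fun j : Fin k => distance (P i) (P (s j))
  let l ← forEach (List.finRange n) [] fun i acc =>
    forEach (List.finRange k) acc fun j acc' => ops 2 (D i j :: acc')
  let R ← sort l.length l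
  let ts ← tuples k k
  let m ← ops 1 (n * k)
  let best ← forEach ts none fun t best => binarySearch D L U R t m 0 m best
  match best with
  | none => ops 1 none
  | some b => do
    let x ← roundSolution b.sol
    let reg ← allRegions D b.tuple b.radius
    let a ← distribute reg x
    let c ← tabulate fun j => ops 2 (s (b.tuple j))
    ops 1 (some ⟨a, c, b.radius⟩)

end BalancedKCenter

end

/-! Approximation. If `k` balls of radius `r` cover `P`, every point lies within `2 * r` of a point
selected by Gonzalez's algorithm: otherwise that point and the `k` selected ones would be `k + 1`
points pairwise more than `2 * r` apart, and two of them would share a ball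
(`exists_dist_gonzalez_le`). Given a balanced clustering of radius `r`, pick a point in each
cluster, which is possible since `1 ≤ L`, and replace the center by a selected point within `2 * r`
of the picked one. The clusters stay the same, and each point is now within `r + r + 2 * r = 4 * r`
of its new center. The largest of these new distances is an entry of the distance table, so some
tuple is feasible at some candidate radius at most `4 * r` (`exists_feasible_entry`). The search
records a radius no larger than any feasible candidate (`binarySearch_spec`, `bestRecord_spec`).
This holds for every `r` of a balanced clustering, hence for the infimum.

The test. An assignment of the points gives an integral solution of the system. `solve` decides
rational solvability by Gaussian elimination on equations and Fourier–Motzkin elimination on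
inequalities (`solve_spec`). Conversely, a rational solution can be made integral. The values in a
region add up to an integer, so a region with one fractional value has another, and a walk through
fractional values ends in a cycle or in a ball with only one such value. A shift along a cycle keeps
all sums. A shift along a path changes only the two end clusters; when each of these has a single
fractional value, staying between its floor and its ceiling respects the integers `L` and `U`. Each
shift makes a value integral and none fractional (`isSolution_roundStep`). Integral values are
quotas by which the points are dealt out (`distribute_spec`).

Time. The size of the system depends on `k` only, so under unit cost solving and rounding take
constant time, and a test is linear in `n`. There are `O(log n)` tests for each tuple. Sorting `n *
k` numbers takes `O(n log n)` and the distances take `O(n d)`, for fixed `k`. -/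

namespace BalancedKCenter

/-! ### Steps and loops -/

section

variable {α β : Type}

@[simp] theorem pure_val (a : α) : (pure a : Timed α).val = a := rfl

@[simp] theorem pure_time (a : α) : (pure a : Timed α).time = 0 := rfl

@[simp] theorem bind_val (x : Timed α) (f : α → Timed β) : (x >>= f).val = (f x.val).val := rfl

@[simp] theorem bind_time (x : Timed α) (f : α → Timed β) :
    (x >>= f).time = x.time + (f x.val).time := rfl

@[simp] theorem ops_val (c : ℕ) (a : α) : (ops c a).val = a := rfl

@[simp] theorem ops_time (c : ℕ) (a : α) : (ops c a).time = c := rfl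

@[simp] theorem tick_time : tick.time = 1 := rfl

@[simp] theorem tabulate_val {ι : Type} [Fintype ι] (f : ι → Timed α) :
    (tabulate f).val = fun i => (f i).val := rfl

theorem tabulate_time {ι : Type} [Fintype ι] (f : ι → Timed α) :
    (tabulate f).time = ∑ i, ((f i).time + 1) := rfl

theorem tabulate_time_le {ι : Type} [Fintype ι] {f : ι → Timed α} {c : ℕ}
    (h : ∀ i, (f i).time ≤ c) : (tabulate f).time ≤ Fintype.card ι * (c + 1) := by
  rw [tabulate_time]
  refine (Finset.sum_le_card_nsmul _ _ (c + 1) fun i _ => by simpa using h i).trans ?_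
  simp

@[simp] theorem ite_val (p : Prop) [Decidable p] (x y : Timed α) :
    (if p then x else y).val = if p then x.val else y.val := by split <;> rfl

@[simp] theorem ite_time (p : Prop) [Decidable p] (x y : Timed α) :
    (if p then x else y).time = if p then x.time else y.time := by split <;> rfl

@[simp] theorem forEach_val (l : List α) (b : β) (f : α → β → Timed β) :
    (forEach l b f).val = l.foldl (fun b a => (f a b).val) b := by
  induction l generalizing b with
  | nil => rfl
  | cons a l ih => simp [forEach, ih]

/-- A loop whose body preserves `p` and, under `p`, costs at most `c`. -/
theorem forEach_time_le_of_inv {l : List α} {b : β} {f : α → β → Timed β} {c : ℕ} (p : β → Prop)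
    (hb : p b) (hp : ∀ a ∈ l, ∀ b, p b → p (f a b).val)
    (h : ∀ a ∈ l, ∀ b, p b → (f a b).time ≤ c) : (forEach l b f).time ≤ l.length * (c + 1) := by
  induction l generalizing b with
  | nil => simp [forEach]
  | cons a l ih =>
    have h1 := h a (by simp) b hb
    have h2 := ih (hp a (by simp) b hb) (fun a ha => hp a (by simp [ha]))
      (fun a ha => h a (by simp [ha]))
    simp only [forEach, bind_time, tick_time, List.length_cons]
    linarith

theorem forEach_time_le {l : List α} {b : β} {f : α → β → Timed β} {c : ℕ}
    (h : ∀ a ∈ l, ∀ b, (f a b).time ≤ c) : (forEach l b f).time ≤ l.length * (c + 1) :=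
  forEach_time_le_of_inv (fun _ => True) trivial (fun _ _ _ _ => trivial) fun a ha b _ => h a ha b

@[simp] theorem findFirst_val (p : α → Timed Bool) (l : List α) :
    (findFirst p l).val = l.find? fun a => (p a).val := by
  induction l with
  | nil => rfl
  | cons a l ih =>
    simp only [findFirst, bind_val, ite_val, ih, ops_val, List.find?_cons]
    cases (p a).val <;> rfl

theorem findFirst_time_le {p : α → Timed Bool} {l : List α} {c : ℕ}
    (h : ∀ a ∈ l, (p a).time ≤ c) : (findFirst p l).time ≤ l.length * (c + 1) + 1 := by
  induction l with
  | nil => simp [findFirst]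
  | cons a l ih =>
    have h1 := h a (by simp)
    have h2 := ih fun a ha => h a (by simp [ha])
    simp only [findFirst, bind_time, tick_time, List.length_cons, ite_time, ops_time]
    split <;> nlinarith

/-- Induction along the prefixes of the list of a `foldl`. -/
theorem foldl_prefix_induction {l : List α} {f : β → α → β} {b : β} (p : List α → β → Prop)
    (h0 : p [] b) (hs : ∀ l₁ a l₂ b, l = l₁ ++ a :: l₂ → p l₁ b → p (l₁ ++ [a]) (f b a)) :
    p l (l.foldl f b) := by
  suffices h : ∀ l₂ l₁ b, l = l₁ ++ l₂ → p l₁ b → p l (l₂.foldl f b) from h l [] b rfl h0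
  intro l₂
  induction l₂ with
  | nil => intro l₁ b h hp; simpa [h] using hp
  | cons a l₂ ih =>
    intro l₁ b h hp
    exact ih (l₁ ++ [a]) _ (by simp [h]) (hs l₁ a l₂ b h hp)

theorem nth_val (l : List ℝ) (i : ℕ) : (nth l i).val = l.getD i 0 := by
  induction l generalizing i with
  | nil => rfl
  | cons a l ih => cases i <;> simp [nth, ih]

theorem nth_time_le (l : List ℝ) (i : ℕ) : (nth l i).time ≤ l.length + 1 := by
  induction l generalizing i with
  | nil => simp [nth]
  | cons a l ih =>
    cases i with
    | zero => simp [nth]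
    | succ i => have := ih i; simp [nth]; omega

/-! ### Distances and Gonzalez's algorithm -/

theorem distance_val {d : ℕ} (p q : EuclideanSpace ℝ (Fin d)) : (distance p q).val = dist p q := by
  have h : ∀ (l : List (Fin d)) (b : ℝ),
      l.foldl (fun acc c => acc + (p c - q c) * (p c - q c)) b =
        b + (l.map fun c => (p c - q c) ^ 2).sum := by
    intro l
    induction l with
    | nil => simp
    | cons a l ih => intro b; simp [ih]; ring
  simp [distance, EuclideanSpace.dist_eq, h, Real.dist_eq, sq_abs, Fin.sum_univ_def]

theorem distance_time_le {d : ℕ} (p q : EuclideanSpace ℝ (Fin d)) :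
    (distance p q).time ≤ 9 * d + 1 := by
  have := forEach_time_le (l := List.finRange d) (b := (0 : ℝ)) (c := 8)
    (f := fun c acc => ops 8 (acc + (p c - q c) * (p c - q c))) (by simp)
  simp [distance] at this ⊢
  omega

theorem le_argmax {n : ℕ} (m : Fin n → ℝ) (i₀ i : Fin n) : m i ≤ m (argmax m i₀).val := by
  have := foldl_prefix_induction (l := List.finRange n) (b := i₀)
    (f := fun b i => if m b < m i then i else b) (fun l b => ∀ i ∈ l, m i ≤ m b) (by simp) (by
      intro l₁ a l₂ b _ h i hi
      rcases List.mem_append.1 hi with hi | hi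
      · have := h i hi
        split <;> linarith
      · obtain rfl := List.mem_singleton.1 hi
        split <;> linarith)
  simpa [argmax] using this i (List.mem_finRange i)

theorem argmax_time_le {n : ℕ} (m : Fin n → ℝ) (i₀ : Fin n) : (argmax m i₀).time ≤ 5 * n := by
  have := forEach_time_le (l := List.finRange n) (b := i₀) (c := 4)
    (f := fun i b => ops 4 (if m b < m i then i else b)) (by simp)
  simp [argmax] at this ⊢
  omega

/-- Every selected point is at largest minimum distance to the ones selected before. -/
theorem gonzalez_spec {n d k : ℕ} (P : Fin n → EuclideanSpace ℝ (Fin d)) (i₀ : Fin n)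
    (j : Fin k) (a : Fin n) (ρ : ℝ)
    (h : ∀ i < j, ρ < dist (P a) (P ((gonzalez k P i₀).val i))) (i : Fin k) (hi : i < j) :
    ρ < dist (P ((gonzalez k P i₀).val j)) (P ((gonzalez k P i₀).val i)) := by
  obtain ⟨k, rfl⟩ : ∃ k', k = k' + 1 := ⟨k - 1, by have := j.pos; omega⟩
  set body : Fin (k + 1) → (Fin (k + 1) → Fin n) × (Fin n → ℝ) →
      (Fin (k + 1) → Fin n) × (Fin n → ℝ) := fun j st =>
    (Function.update st.1 j (argmax st.2 i₀).val,
      fun a => min (st.2 a) (dist (P a) (P (argmax st.2 i₀).val))) with hbody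
  have hval : (gonzalez (k + 1) P i₀).val = ((List.finRange (k + 1)).tail.foldl
      (fun st j => body j st) (fun _ => i₀, fun a => dist (P a) (P i₀))).1 := by
    simp [gonzalez, distance_val, hbody]
  have key := foldl_prefix_induction (l := (List.finRange (k + 1)).tail)
    (b := ((fun _ => i₀, fun a => dist (P a) (P i₀)) :
      (Fin (k + 1) → Fin n) × (Fin n → ℝ)))
    (f := fun st j => body j st)
    -- After the loop has treated `l`, exactly the indices below `l.length + 1` hold selected
    -- points, index `0` being the start. That `st.2 a` is the minimum distance to them is expressed
    -- by thresholds `ρ`, which avoids a minimum over a varying set.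
    (fun l st => (∀ a ρ, ρ < st.2 a ↔ ∀ i, i.val < l.length + 1 → ρ < dist (P a) (P (st.1 i))) ∧
      ∀ j : Fin (k + 1), j.val < l.length + 1 → ∀ a ρ,
        (∀ i < j, ρ < dist (P a) (P (st.1 i))) → ∀ i < j, ρ < dist (P (st.1 j)) (P (st.1 i)))
    (by
      refine ⟨fun a ρ => ⟨fun h i _ => h, fun h => h 0 (by simp)⟩, fun j hj a ρ _ i hi => ?_⟩
      simp at hj
      simp [hj] at hi)
    (by
      rintro l₁ j l₂ ⟨s, m⟩ hl ⟨h1, h2⟩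
      have hj : j.val = l₁.length + 1 := by
        have h := congrArg (fun l => l[l₁.length]?) hl
        simp [List.finRange_succ] at h
        obtain ⟨a, ha1, ha2⟩ := h
        rw [← ha2, Fin.val_succ]
        rw [List.getElem?_eq_some_iff] at ha1
        obtain ⟨hlt, h3⟩ := ha1
        simp at h3
        rw [← h3]
      have hne : ∀ i : Fin (k + 1), i.val < l₁.length + 1 → i ≠ j := by
        rintro i hi rfl; omega
      simp only at h1 h2
      refine ⟨fun a ρ => ?_, fun j' hj' a ρ h i hi => ?_⟩
      · simp only [hbody, lt_min_iff, h1, List.length_append, List.length_singleton]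
        constructor
        · rintro ⟨ha, hb⟩ i hi
          rcases eq_or_ne i j with rfl | hij
          · simpa using hb
          · rw [Function.update_of_ne hij]
            have : i.val ≠ j.val := fun h => hij (Fin.ext h)
            exact ha i (by omega)
        · intro h
          refine ⟨fun i hi => ?_, ?_⟩
          · simpa [Function.update_of_ne (hne i hi)] using h i (by omega)
          · simpa using h j (by omega)
      · simp only [hbody, List.length_append, List.length_singleton] at *
        rcases eq_or_ne j' j with rfl | hjj
        · have hij : ∀ i : Fin (k + 1), i.val < l₁.length + 1 → i < j' := fun i hi => by
            rw [Fin.lt_def]; omega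
          rw [Function.update_self, Function.update_of_ne hi.ne]
          -- The point `a` has a table value above `ρ`, so the maximum of the table, attained at the
          -- new point, is above `ρ` too.
          refine (h1 _ _).1 (lt_of_lt_of_le ((h1 a ρ).2 fun i hi => ?_) (le_argmax m i₀ a)) i ?_
          · simpa [Function.update_of_ne (hne i hi)] using h i (hij i hi)
          · rw [Fin.lt_def] at hi; omega
        · have hjn : j'.val ≠ j.val := fun h => hjj (Fin.ext h)
          have hlt : j'.val < l₁.length + 1 := by omega
          have hu : ∀ i ≤ j', Function.update s j (argmax m i₀).val i = s i := fun i hi =>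
            Function.update_of_ne (hne i (by rw [Fin.le_def] at hi; omega)) _ _
          rw [hu j' le_rfl, hu i hi.le]
          exact h2 j' hlt a ρ (fun i hi => by simpa [hu i hi.le] using h i hi) i hi)
  rw [← hval] at key
  refine key.2 j ?_ a ρ h i hi
  simp
  omega

/-- If `k` balls of radius `r` cover the points, then those of radius `2 * r` around the selected
points do. -/
theorem exists_dist_gonzalez_le {n d k : ℕ} (P : Fin n → EuclideanSpace ℝ (Fin d)) (i₀ : Fin n)
    (a : Fin n → Fin k) (c : Fin k → EuclideanSpace ℝ (Fin d)) (r : ℝ)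
    (h : ∀ i, dist (P i) (c (a i)) ≤ r) (i : Fin n) :
    ∃ j, dist (P i) (P ((gonzalez k P i₀).val j)) ≤ 2 * r := by
  by_contra! hcon
  set s := (gonzalez k P i₀).val with hs
  -- The uncovered point `i` is far from all selected points, so each of them, being a farthest
  -- choice, was at least as far from its predecessors.
  have hsep : ∀ j, ∀ l < j, 2 * r < dist (P (s j)) (P (s l)) := fun j l hl =>
    gonzalez_spec P i₀ j i (2 * r) (fun l _ => hcon l) l hl
  have hclose : ∀ x y, a x = a y → dist (P x) (P y) ≤ 2 * r := fun x y hxy => by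
    have h1 := h x
    have h2 := h y
    rw [← hxy] at h2
    linarith [dist_triangle_right (P x) (P y) (c (a x))]
  -- Pigeonhole for `k + 1` points in `k` clusters; `none` stands for the uncovered point `i`.
  obtain ⟨x, y, hxy, he⟩ := Fintype.exists_ne_map_eq_of_card_lt
    (fun o : Option (Fin k) => a (o.elim i s)) (by simp)
  rcases x with _ | x <;> rcases y with _ | y
  · exact hxy rfl
  · exact (hcon y).not_ge (hclose _ _ he)
  · exact (hcon x).not_ge (hclose _ _ he.symm)
  · rcases lt_trichotomy x y with hlt | rfl | hlt
    · exact (hsep _ _ hlt).not_ge (hclose _ _ he.symm)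
    · exact hxy rfl
    · exact (hsep _ _ hlt).not_ge (hclose _ _ he)

theorem gonzalez_time_le {n d k : ℕ} (P : Fin n → EuclideanSpace ℝ (Fin d)) (i₀ : Fin n) :
    (gonzalez k P i₀).time ≤ 2 * k + n * (9 * d + 2) + k * (5 * n + n * (9 * d + 5) + 2) := by
  have h1 : (tabulate fun _ : Fin k => ops 1 i₀).time ≤ k * 2 := by
    simpa using tabulate_time_le (f := fun _ : Fin k => ops 1 i₀) (c := 1) (by simp)
  have h2 : (tabulate fun a => distance (P a) (P i₀)).time ≤ n * (9 * d + 2) := by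
    simpa using tabulate_time_le (f := fun a => distance (P a) (P i₀)) fun a =>
      distance_time_le _ _
  have h3 : ∀ (m : Fin n → ℝ) (i : Fin n), (tabulate fun a => do
      let x ← distance (P a) (P i)
      ops 3 (min (m a) x)).time ≤ n * (9 * d + 5) := fun m i => by
    simpa using tabulate_time_le (f := fun a => do
      let x ← distance (P a) (P i)
      ops 3 (min (m a) x)) (c := 9 * d + 4) fun a => by
        have := distance_time_le (P a) (P i)
        simp; omega
  have h4 := forEach_time_le (l := (List.finRange k).tail)
    (b := ((fun _ => i₀, fun a => dist (P a) (P i₀)) : (Fin k → Fin n) × (Fin n → ℝ)))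
    (c := 5 * n + n * (9 * d + 5) + 1)
    (f := fun j st => do
      let i ← argmax st.2 i₀
      let s ← ops 1 (Function.update st.1 j i)
      let m ← tabulate fun a => do
        let x ← distance (P a) (P i)
        ops 3 (min (st.2 a) x)
      pure (s, m)) fun j _ st => by
        have := h3 st.2 (argmax st.2 i₀).val
        have := argmax_time_le st.2 i₀
        simp only [bind_time, ops_time, pure_time]
        omega
  have h5 : (List.finRange k).tail.length ≤ k := by simp
  have h6 := h4.trans (Nat.mul_le_mul_right _ h5)
  simp only [gonzalez, bind_time, pure_time, ops_val, tabulate_val, distance_val] at *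
  exact (add_le_add h1 (add_le_add h2 (add_le_add h6 le_rfl))).trans (by grind)

/-! ### Sorting -/

theorem split_perm (l : List ℝ) : ((split l).val.1 ++ (split l).val.2).Perm l := by
  induction l with
  | nil => simp [split]
  | cons a l ih =>
    simp only [split, bind_val, ops_val, List.cons_append]
    exact (List.perm_append_comm.trans ih).cons a

/-- The halves change places at every element, so they grow alternately. -/
theorem split_length (l : List ℝ) :
    (split l).val.1.length = (l.length + 1) / 2 ∧ (split l).val.2.length = l.length / 2 := by
  induction l with
  | nil => simp [split]
  | cons a l ih =>
    simp only [split, bind_val, ops_val, List.length_cons]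
    omega

theorem split_time (l : List ℝ) : (split l).time = 3 * l.length + 1 := by
  induction l with
  | nil => simp [split]
  | cons a l ih =>
    simp only [split, bind_time, ops_time, List.length_cons, ih]
    omega

theorem merge_perm (l l' : List ℝ) : (merge l l').val.Perm (l ++ l') := by
  fun_induction merge l l' with
  | case1 => simp
  | case2 => simp
  | case3 a l b l' ih1 ih2 =>
    simp only [bind_val, ite_val, ops_val, decide_eq_true_eq]
    split
    · exact ih1.cons a
    · exact (ih2.cons b).trans List.perm_middle.symm

theorem merge_sorted (l l' : List ℝ) (h : l.Pairwise (· ≤ ·)) (h' : l'.Pairwise (· ≤ ·)) :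
    (merge l l').val.Pairwise (· ≤ ·) := by
  fun_induction merge l l' with
  | case1 => exact h'
  | case2 => exact h
  | case3 a l b l' ih1 ih2 =>
    have ha := List.pairwise_cons.1 h
    have hb := List.pairwise_cons.1 h'
    simp only [bind_val, ite_val, ops_val, decide_eq_true_eq]
    split
    · rename_i hab
      refine List.pairwise_cons.2 ⟨fun x hx => ?_, ih1 ha.2 h'⟩
      rcases List.mem_append.1 ((merge_perm _ _).mem_iff.1 hx) with hx | hx
      · exact ha.1 x hx
      · rcases List.mem_cons.1 hx with rfl | hx
        · exact hab
        · exact hab.trans (hb.1 x hx)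
    · rename_i hab
      refine List.pairwise_cons.2 ⟨fun x hx => ?_, ih2 h hb.2⟩
      rcases List.mem_append.1 ((merge_perm _ _).mem_iff.1 hx) with hx | hx
      · rcases List.mem_cons.1 hx with rfl | hx
        · linarith
        · linarith [ha.1 x hx]
      · exact hb.1 x hx

theorem merge_time_le (l l' : List ℝ) : (merge l l').time ≤ 4 * (l.length + l'.length) + 1 := by
  fun_induction merge l l' with
  | case1 => simp
  | case2 => simp
  | case3 a l b l' ih1 ih2 =>
    simp only [bind_time, ite_time, ops_time, List.length_cons] at *
    split <;> omega

theorem sort_perm (f : ℕ) (l : List ℝ) : (sort f l).val.Perm l := by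
  fun_induction sort f l with
  | case1 f a b l ih1 ih2 =>
    simp only [bind_val]
    exact (merge_perm _ _).trans (((ih1 _).append (ih2 _)).trans (split_perm _))
  | case2 => simp

/-- The recursion depth suffices because both halves of a list with at least two elements are
strictly shorter. -/
theorem sort_sorted (f : ℕ) (l : List ℝ) (h : l.length ≤ f) :
    (sort f l).val.Pairwise (· ≤ ·) := by
  fun_induction sort f l with
  | case1 f a b l ih1 ih2 =>
    have hs := split_length (a :: b :: l)
    simp only [List.length_cons] at h hs
    simp only [bind_val]
    exact merge_sorted _ _ (ih1 _ (by omega)) (ih2 _ (by omega))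
  | case2 f l hl =>
    rcases l with _ | ⟨a, _ | ⟨b, l⟩⟩
    · simp
    · simp
    · rcases f with _ | f
      · simp at h
      · exact absurd rfl (hl f a b l rfl)

/-- At length `ℓ ≥ 2`, splitting costs `3ℓ + 1` and merging at most `4ℓ + 1`; with the additive
constants of the two recursive calls this is `7ℓ + 4 ≤ 9ℓ + 1`, so each of the `m` halvings
contributes at most `9ℓ`. -/
theorem sort_time_le (f : ℕ) (l : List ℝ) (m : ℕ) (h : l.length ≤ 2 ^ m) :
    (sort f l).time ≤ 9 * l.length * (m + 1) + 1 := by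
  induction m generalizing f l with
  | zero =>
    rcases l with _ | ⟨a, _ | ⟨b, l⟩⟩
    · cases f <;> simp [sort]
    · cases f <;> simp [sort]
    · simp at h
  | succ m ih =>
    fun_cases sort f l with
    | case1 f a b l =>
      have hs := split_length (a :: b :: l)
      have ht := split_time (a :: b :: l)
      set L := a :: b :: l
      have hL : 2 ≤ L.length := by simp [L]
      have h1 := ih f (split L).val.1 (by rw [hs.1]; rw [pow_succ] at h; omega)
      have h2 := ih f (split L).val.2 (by rw [hs.2]; rw [pow_succ] at h; omega)
      have h3 := merge_time_le (sort f (split L).val.1).val (sort f (split L).val.2).val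
      rw [(sort_perm _ _).length_eq, (sort_perm _ _).length_eq] at h3
      have h4 : (split L).val.1.length + (split L).val.2.length = L.length := by omega
      rw [h4] at h3
      simp only [bind_time]
      have h5 : 9 * (split L).val.1.length * (m + 1) + 9 * (split L).val.2.length * (m + 1) =
        9 * L.length * (m + 1) := by rw [← h4]; ring
      have h6 : 9 * L.length * (m + 1 + 1) = 9 * L.length * (m + 1) + 9 * L.length := by ring
      omega
    | case2 => simp

end

/-! ### Elimination of variables -/

section

variable {α β : Type}

/-- Describes a list accumulated by a loop through membership alone, which is all that matters for a
system of constraints or a set of candidates. -/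
theorem mem_foldl_iff {γ : Type} {l : List α} {f : List γ → α → List γ} {b : List γ} {x : γ}
    (q : α → γ → Prop) (h : ∀ a ∈ l, ∀ b, x ∈ f b a ↔ x ∈ b ∨ q a x) :
    x ∈ l.foldl f b ↔ x ∈ b ∨ ∃ a ∈ l, q a x := by
  induction l generalizing b with
  | nil => simp
  | cons a l ih =>
    rw [List.foldl_cons, ih fun a ha => h a (by simp [ha]), h a (by simp)]
    simp [or_assoc]

variable {k : ℕ}

/-! ### Enumeration of regions and variables -/

theorem mem_regions (T : Region k) : T ∈ regions k := by
  refine List.mem_map.2 ⟨(List.finRange k).filter (· ∈ T), ?_, ?_⟩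
  · exact List.mem_sublists.2 List.filter_sublist
  · ext; simp

/-- Sublists of `List.finRange k` are strictly increasing, so each is determined by its set of
entries. -/
theorem regions_nodup : (regions k).Nodup := by
  refine List.Nodup.map_on ?_ (List.nodup_sublists.2 (List.nodup_finRange k))
  intro x hx y hy hxy
  rw [List.mem_sublists] at hx hy
  have hs : (List.finRange k).Pairwise (· < ·) := by
    simpa using List.pairwise_lt_finRange k
  have hx' := hs.sublist hx
  have hy' := hs.sublist hy
  refine List.Perm.eq_of_pairwise (le := (· < ·)) (fun a b _ _ h1 h2 =>
    absurd h1 h2.asymm) hx' hy' ?_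
  exact List.perm_of_nodup_nodup_toFinset_eq ((List.nodup_finRange k).sublist hx)
    ((List.nodup_finRange k).sublist hy) hxy

theorem mem_vars (v : Var k) : v ∈ vars k :=
  List.mem_product.2 ⟨mem_regions _, List.mem_finRange _⟩

theorem vars_nodup : (vars k).Nodup := regions_nodup.product (List.nodup_finRange k)

theorem toFinset_vars : (vars k).toFinset = Finset.univ := by
  ext v; simp [mem_vars]

namespace Constraint

/-- The left-hand side of a constraint. -/
def lhs (c : Constraint k) (x : Var k → ℚ) : ℚ := ∑ v, c.coef v * x v

/-- The left-hand side without the variable `v`. -/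
def rest (c : Constraint k) (v : Var k) (x : Var k → ℚ) : ℚ :=
  ∑ w ∈ Finset.univ.erase v, c.coef w * x w

/-- `x` satisfies the constraint. -/
def Holds (c : Constraint k) (x : Var k → ℚ) : Prop :=
  if c.isEq then c.lhs x = c.rhs else c.lhs x ≤ c.rhs

theorem lhs_eq (c : Constraint k) (v : Var k) (x : Var k → ℚ) :
    c.lhs x = c.rest v x + c.coef v * x v :=
  (Finset.sum_erase_add _ _ (Finset.mem_univ v)).symm

theorem lhs_update (c : Constraint k) (v : Var k) (x : Var k → ℚ) (y : ℚ) :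
    c.lhs (Function.update x v y) = c.rest v x + c.coef v * y := by
  rw [lhs_eq c v, Function.update_self]
  congr 1
  refine Finset.sum_congr rfl fun w hw => ?_
  rw [Function.update_of_ne (Finset.ne_of_mem_erase hw)]

end Constraint

theorem bound_val (v : Var k) (x : Var k → ℚ) (c : Constraint k) :
    (bound v x c).val = (c.rhs - c.rest v x) / c.coef v := by
  have h : ∀ (l : List (Var k)) (b : ℚ),
      l.foldl (fun acc w => if w = v then acc else acc - c.coef w * x w) b =
        b - (l.map fun w => if w = v then 0 else c.coef w * x w).sum := by
    intro l
    induction l with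
    | nil => simp
    | cons a l ih => intro b; rw [List.foldl_cons, ih]; split <;> simp [*]; ring
  have h2 : c.rest v x = ∑ w, if w = v then 0 else c.coef w * x w := by
    rw [Constraint.rest, ← Finset.sum_erase_add _ _ (Finset.mem_univ v), if_pos rfl, add_zero]
    exact Finset.sum_congr rfl fun w hw => (if_neg (Finset.ne_of_mem_erase hw)).symm
  simp only [bound, bind_val, forEach_val, ops_val, h]
  rw [h2, ← toFinset_vars, List.sum_toFinset _ vars_nodup]

theorem mem_select {v : Var k} {p : ℚ → Prop} [DecidablePred p] {cs : List (Constraint k)}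
    {c : Constraint k} : c ∈ (select v p cs).val ↔ c ∈ cs ∧ p (c.coef v) := by
  simp only [select, forEach_val, ops_val]
  rw [mem_foldl_iff fun a c => c = a ∧ p (a.coef v)]
  · aesop
  · intro a _ b
    split <;> simp_all [or_comm]

theorem lhs_substitute (v : Var k) (e c : Constraint k) (x : Var k → ℚ) :
    (substitute v e c).val.lhs x = c.lhs x - c.coef v / e.coef v * e.lhs x := by
  simp only [substitute, bind_val, ops_val, tabulate_val, Constraint.lhs, Finset.mul_sum,
    ← Finset.sum_sub_distrib]
  exact Finset.sum_congr rfl fun _ _ => by ring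

theorem lhs_combine (v : Var k) (p q : Constraint k) (x : Var k → ℚ) :
    (combine v p q).val.lhs x = -(q.coef v) * p.lhs x + p.coef v * q.lhs x := by
  simp only [combine, bind_val, ops_val, tabulate_val, Constraint.lhs, Finset.mul_sum,
    ← Finset.sum_add_distrib]
  exact Finset.sum_congr rfl fun _ _ => by ring

theorem mem_eliminate {v : Var k} {cs : List (Constraint k)} {c : Constraint k} :
    c ∈ (eliminate v cs).val ↔ (c ∈ cs ∧ c.coef v = 0) ∨
      ∃ p ∈ cs, 0 < p.coef v ∧ ∃ q ∈ cs, q.coef v < 0 ∧ c = (combine v p q).val := by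
  simp only [eliminate, bind_val, forEach_val, ops_val]
  rw [mem_foldl_iff fun p c => ∃ q ∈ cs, q.coef v < 0 ∧ c = (combine v p q).val, mem_select]
  · simp only [mem_select, and_assoc]
  · intro p _ b
    rw [mem_foldl_iff fun q c => c = (combine v p q).val]
    · simp only [mem_select, and_assoc]
    · intro q _ b
      rw [List.mem_cons, or_comm]

/-- The order `r` is abstract so that one proof serves the maximum of the lower bounds and the
minimum of the upper bounds. The accumulator is `none` exactly while no element has been seen. -/
theorem foldl_extremum {r : ℚ → ℚ → Prop} {m : ℚ → ℚ → ℚ} (hl : ∀ a b, r a (m a b))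
    (hr : ∀ a b, r b (m a b)) (hm : ∀ a b, m a b = a ∨ m a b = b) (hrefl : ∀ a, r a a)
    (htrans : ∀ a b c, r a b → r b c → r a c) (g : α → ℚ) (l : List α) :
    (l.foldl (fun acc c => some (acc.elim (g c) (m (g c)))) none).elim (l = []) fun b =>
      (∃ c ∈ l, g c = b) ∧ ∀ c ∈ l, r (g c) b := by
  refine foldl_prefix_induction (p := fun (l : List α) (o : Option ℚ) => o.elim (l = []) fun b =>
      (∃ c ∈ l, g c = b) ∧ ∀ c ∈ l, r (g c) b) (by simp) fun l₁ a l₂ o _ h => ?_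
  rcases o with _ | b
  · simp only [Option.elim_none] at h
    simp [h, hrefl]
  · simp only [Option.elim_some] at h ⊢
    obtain ⟨⟨c, hc, rfl⟩, h2⟩ := h
    refine ⟨?_, fun c' hc' => ?_⟩
    · rcases hm (g a) (g c) with h | h
      · exact ⟨a, by simp, h.symm⟩
      · exact ⟨c, by simp [hc], h.symm⟩
    · rcases List.mem_append.1 hc' with hc' | hc'
      · exact htrans _ _ _ (h2 c' hc') (hr _ _)
      · obtain rfl := List.mem_singleton.1 hc'
        exact hl _ _

/-- `chooseValue` lies between all lower and all upper bounds, if these are compatible. -/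
theorem chooseValue_spec (v : Var k) (cs : List (Constraint k)) (x : Var k → ℚ)
    (h : ∀ p ∈ cs, 0 < p.coef v → ∀ q ∈ cs, q.coef v < 0 → (bound v x q).val ≤ (bound v x p).val) :
    (∀ p ∈ cs, 0 < p.coef v → (chooseValue v cs x).val ≤ (bound v x p).val) ∧
      ∀ q ∈ cs, q.coef v < 0 → (bound v x q).val ≤ (chooseValue v cs x).val := by
  have h1 := foldl_extremum (r := (· ≤ ·)) (m := max) le_max_left le_max_right max_choice le_refl
    (fun _ _ _ => le_trans) (fun c => (bound v x c).val) (select v (fun q => q < 0) cs).val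
  have h2 := foldl_extremum (r := (· ≥ ·)) (m := min) min_le_left min_le_right min_choice le_refl
    (fun _ _ _ h h' => le_trans h' h) (fun c => (bound v x c).val)
    (select v (fun q => 0 < q) cs).val
  simp only [chooseValue, bind_val, forEach_val, ops_val]
  generalize List.foldl _ _ (select v (fun q => q < 0) cs).val = o1 at *
  rcases o1 with _ | b
  · have hneg : ∀ q ∈ cs, ¬ q.coef v < 0 := fun q hq hlt => by
      have := (mem_select (p := fun q => q < 0)).2 ⟨hq, hlt⟩
      simp only [Option.elim_none] at h1
      simp [h1] at this
    refine ⟨fun p hp hpos => ?_, fun q hq hlt => absurd hlt (hneg q hq)⟩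
    simp only [bind_val, forEach_val, ops_val]
    generalize List.foldl _ _ (select v (fun q => 0 < q) cs).val = o2 at *
    have hp' := (mem_select (p := fun q => 0 < q)).2 ⟨hp, hpos⟩
    rcases o2 with _ | b
    · simp only [Option.elim_none] at h2
      simp [h2] at hp'
    · exact h2.2 p hp'
  · obtain ⟨⟨c, hc, hcb⟩, h3⟩ := h1
    rw [mem_select] at hc
    simp only [ops_val]
    refine ⟨fun p hp hpos => ?_, fun q hq hlt => h3 q (mem_select.2 ⟨hq, hlt⟩)⟩
    -- The largest lower bound is attained by a constraint `c`, which is compatible with every upper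
    -- bound by `h`.
    rw [← hcb]
    exact h p hp hpos c hc.1 hc.2

/-- Induction on the variables still to be eliminated. The hypothesis `hs` says that no other
variable occurs: at the end all left-hand sides vanish, and resetting an eliminated variable cannot
disturb the reduced system. -/
theorem solve_spec (vs : List (Var k)) (cs : List (Constraint k))
    (hs : ∀ c ∈ cs, ∀ w ∉ vs, c.coef w = 0) :
    (∀ x, (solve vs cs).val = some x → ∀ c ∈ cs, c.Holds x) ∧
      ((∃ x, ∀ c ∈ cs, c.Holds x) → ∃ x, (solve vs cs).val = some x) := by
  induction vs generalizing cs with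
  | nil =>
    have h : ∀ (l : List (Constraint k)) (b : Bool), l.foldl (fun acc c =>
        acc && (if c.isEq then decide (c.rhs = 0) else decide (0 ≤ c.rhs))) b = true ↔ b = true ∧
          ∀ c ∈ l, if c.isEq then c.rhs = 0 else 0 ≤ c.rhs := by
      intro l
      induction l with
      | nil => simp
      | cons a l ih => intro b; rw [List.foldl_cons, ih]; cases h : a.isEq <;> simp [h, and_assoc]
    have h0 : ∀ c ∈ cs, ∀ x, c.lhs x = 0 := fun c hc x => by
      simp [Constraint.lhs, hs c hc]
    have h1 : ∀ x, (∀ c ∈ cs, c.Holds x) ↔ ∀ c ∈ cs, if c.isEq then c.rhs = 0 else 0 ≤ c.rhs := by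
      intro x
      refine forall₂_congr fun c hc => ?_
      rw [Constraint.Holds, h0 c hc]
      simp only [eq_comm]
    simp only [solve, bind_val, forEach_val, ops_val, tabulate_val, h, true_and, h1]
    constructor
    · intro x hx
      split at hx
      · assumption
      · cases hx
    · rintro ⟨_, h⟩
      rw [if_pos h]
      exact ⟨_, rfl⟩
  | cons v vs ih =>
    simp only [solve, bind_val, findFirst_val, ops_val]
    cases hfind : cs.find? (fun c => c.isEq && decide (c.coef v ≠ 0)) with
    | some e =>
      have he := List.mem_of_find?_eq_some hfind
      have hep := List.find?_some hfind
      simp only [ne_eq, decide_not, Bool.and_eq_true, Bool.not_eq_eq_eq_not, Bool.not_true,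
        decide_eq_false_iff_not] at hep
      obtain ⟨heq, hev⟩ := hep
      simp only [bind_val, forEach_val, ops_val]
      set cs' := cs.foldl (fun acc c => (substitute v e c).val :: acc) [] with hcs'
      have hmem : ∀ c', c' ∈ cs' ↔ ∃ c ∈ cs, c' = (substitute v e c).val := fun c' => by
        rw [hcs', mem_foldl_iff fun c c' => c' = (substitute v e c).val]
        · simp
        · intro c _ b
          rw [List.mem_cons, or_comm]
      have hs' : ∀ c ∈ cs', ∀ w ∉ vs, c.coef w = 0 := by
        intro c' hc' w hw
        obtain ⟨c, hc, rfl⟩ := (hmem c').1 hc'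
        simp only [substitute, bind_val, ops_val, tabulate_val]
        rcases eq_or_ne w v with rfl | hwv
        · field_simp; ring
        · rw [hs c hc w (by simp [hw, hwv]), hs e he w (by simp [hw, hwv])]; ring
      -- On the hyperplane of `e`, subtracting a multiple of `e` does not change a constraint. The
      -- equation `e` itself becomes trivial; it is restored by the value that `bound` gives to `v`.
      have hholds : ∀ x, e.lhs x = e.rhs → ∀ c, (substitute v e c).val.Holds x ↔ c.Holds x := by
        intro x hx c
        have h1 : (substitute v e c).val.isEq = c.isEq := rfl
        have h2 : (substitute v e c).val.rhs = c.rhs - c.coef v / e.coef v * e.rhs := rfl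
        simp only [Constraint.Holds, lhs_substitute, h1, h2, hx, sub_left_inj, sub_le_sub_iff_right]
      obtain ⟨ih1, ih2⟩ := ih cs' hs'
      constructor
      · intro x hx
        cases hsol : (solve vs cs').val with
        | none => simp [hsol] at hx
        | some y =>
          simp only [hsol, bind_val, ops_val, Option.some.injEq] at hx
          have hlhs : e.lhs x = e.rhs := by
            rw [← hx, Constraint.lhs_update, bound_val]
            field_simp; ring
          have hx' : ∀ c ∈ cs', c.lhs x = c.lhs y := by
            intro c' hc'
            obtain ⟨c, hc, rfl⟩ := (hmem c').1 hc'
            have h0 : (substitute v e c).val.coef v = 0 := by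
              simp only [substitute, bind_val, ops_val, tabulate_val]
              field_simp; ring
            rw [← hx, Constraint.lhs_update, Constraint.lhs_eq _ v, h0]; ring
          intro c hc
          rw [← hholds x hlhs]
          have hc' := (hmem _).2 ⟨c, hc, rfl⟩
          have := ih1 y hsol _ hc'
          rwa [Constraint.Holds, ← hx' _ hc'] at this
      · rintro ⟨x, hx⟩
        have hlhs : e.lhs x = e.rhs := by
          have := hx e he
          rwa [Constraint.Holds, if_pos heq] at this
        obtain ⟨y, hy⟩ := ih2 ⟨x, fun c' hc' => by
          obtain ⟨c, hc, rfl⟩ := (hmem c').1 hc'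
          exact (hholds x hlhs c).2 (hx c hc)⟩
        simp [hy]
    | none =>
      have hno : ∀ c ∈ cs, c.isEq = true → c.coef v = 0 := by
        intro c hc h
        have := List.find?_eq_none.1 hfind c hc
        simpa [h] using this
      simp only [bind_val]
      have hs' : ∀ c ∈ (eliminate v cs).val, ∀ w ∉ vs, c.coef w = 0 := by
        intro c hc w hw
        rcases mem_eliminate.1 hc with ⟨hc, h0⟩ | ⟨p, hp, hpv, q, hq, hqv, rfl⟩
        · rcases eq_or_ne w v with rfl | hwv
          · exact h0
          · exact hs c hc w (by simp [hw, hwv])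
        · simp only [combine, bind_val, ops_val, tabulate_val]
          rcases eq_or_ne w v with rfl | hwv
          · ring
          · rw [hs p hp w (by simp [hw, hwv]), hs q hq w (by simp [hw, hwv])]; ring
      -- No equation contains `v` in this case, so only inequalities restrict it.
      have hineq : ∀ c ∈ cs, c.coef v ≠ 0 → ∀ x, c.Holds x ↔ c.lhs x ≤ c.rhs := by
        intro c hc h0 x
        rw [Constraint.Holds, if_neg fun h => h0 (hno c hc h)]
      have hcomb : ∀ p q x, (combine v p q).val.Holds x ↔
          -(q.coef v) * p.lhs x + p.coef v * q.lhs x ≤ -(q.coef v) * p.rhs + p.coef v * q.rhs := by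
        intro p q x
        rw [Constraint.Holds, ← lhs_combine, if_neg (by simp [combine])]
        rfl
      obtain ⟨ih1, ih2⟩ := ih _ hs'
      constructor
      · intro x hx
        cases hsol : (solve vs (eliminate v cs).val).val with
        | none => simp [hsol] at hx
        | some y =>
          simp only [hsol, bind_val, ops_val, Option.some.injEq] at hx
          have hy := ih1 y hsol
          -- After clearing denominators, the combined constraint of `p` and `q` says precisely that
          -- the lower bound from `q` is at most the upper bound from `p`.
          obtain ⟨hup, hlo⟩ := chooseValue_spec v cs y (by
            intro p hp hpv q hq hqv
            have := (hcomb p q y).1 (hy _ (mem_eliminate.2 (Or.inr ⟨p, hp, hpv, q, hq, hqv, rfl⟩)))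
            rw [bound_val, bound_val, div_le_iff_of_neg hqv, div_mul_eq_mul_div, div_le_iff₀ hpv]
            rw [Constraint.lhs_eq p v, Constraint.lhs_eq q v] at this
            linarith)
          intro c hc
          rcases lt_trichotomy (c.coef v) 0 with hv | hv | hv
          · rw [hineq c hc hv.ne, ← hx, Constraint.lhs_update]
            have := hlo c hc hv
            rw [bound_val, div_le_iff_of_neg hv] at this
            linarith
          · have h1 := hy c (mem_eliminate.2 (Or.inl ⟨hc, hv⟩))
            have h2 : c.lhs x = c.lhs y := by
              rw [← hx, Constraint.lhs_update, Constraint.lhs_eq _ v, hv]; ring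
            rwa [Constraint.Holds, h2]
          · rw [hineq c hc hv.ne', ← hx, Constraint.lhs_update]
            have := hup c hc hv
            rw [bound_val, le_div_iff₀ hv] at this
            linarith
      · rintro ⟨x, hx⟩
        obtain ⟨y, hy⟩ := ih2 ⟨x, fun c hc => by
          rcases mem_eliminate.1 hc with ⟨hc, -⟩ | ⟨p, hp, hpv, q, hq, hqv, rfl⟩
          · exact hx c hc
          · have h1 := (hineq p hp hpv.ne' x).1 (hx p hp)
            have h2 := (hineq q hq hqv.ne x).1 (hx q hq)
            rw [hcomb]
            -- Both multipliers are positive, so a solution of `p` and `q` satisfies their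
            -- combination.
            exact add_le_add (mul_le_mul_of_nonneg_left h1 (by linarith))
              (mul_le_mul_of_nonneg_left h2 hpv.le)⟩
        simp [hy]

/-- `x` solves the system for the region sizes `cnt`. -/
structure IsSolution (cnt : Region k → ℕ) (L U : ℕ) (x : Var k → ℚ) : Prop where
  sum_region : ∀ T, ∑ j, x (T, j) = cnt T
  le_sum_cluster : ∀ j, (L : ℚ) ≤ ∑ T, x (T, j)
  sum_cluster_le : ∀ j, ∑ T, x (T, j) ≤ U
  nonneg : ∀ v, 0 ≤ x v
  eq_zero : ∀ T j, j ∉ T → x (T, j) = 0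

/-! ### The system for given region sizes -/

theorem lhs_row (isEq : Bool) (p : Var k → Prop) [DecidablePred p] (s b : ℚ) (x : Var k → ℚ) :
    (row isEq p s b).val.lhs x = s * ∑ v, if p v then x v else 0 := by
  simp only [row, bind_val, ops_val, tabulate_val, Constraint.lhs, Finset.mul_sum]
  exact Finset.sum_congr rfl fun v _ => by split <;> simp

theorem holds_row_true (p : Var k → Prop) [DecidablePred p] (s b : ℚ) (x : Var k → ℚ) :
    (row true p s b).val.Holds x ↔ s * (∑ v, if p v then x v else 0) = b := by
  rw [Constraint.Holds, lhs_row]; rfl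

theorem holds_row_false (p : Var k → Prop) [DecidablePred p] (s b : ℚ) (x : Var k → ℚ) :
    (row false p s b).val.Holds x ↔ s * (∑ v, if p v then x v else 0) ≤ b := by
  rw [Constraint.Holds, lhs_row]; rfl

theorem mem_system {cnt : Region k → ℕ} {L U : ℕ} {c : Constraint k} :
    c ∈ (system cnt L U).val ↔
      ((∃ T, c = (row true (fun v => v.1 = T) 1 (cnt T)).val) ∨
      ∃ j, c = (row false (fun v => v.2 = j) 1 U).val ∨
        c = (row false (fun v => v.2 = j) (-1) (-L)).val) ∨
      ∃ v : Var k, c = if v.2 ∈ v.1 then (row false (fun w => w = v) (-1) 0).val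
        else (row true (fun w => w = v) 1 0).val := by
  simp only [system, bind_val, forEach_val, ops_val]
  rw [mem_foldl_iff fun (v : Var k) c => c = if v.2 ∈ v.1 then
      (row false (fun w => w = v) (-1) 0).val else (row true (fun w => w = v) 1 0).val,
    mem_foldl_iff fun j c => c = (row false (fun v => v.2 = j) 1 U).val ∨
      c = (row false (fun v => v.2 = j) (-1) (-L)).val,
    mem_foldl_iff fun T c => c = (row true (fun v => v.1 = T) 1 (cnt T)).val]
  · simp [mem_regions, mem_vars]
  · intro a _ b
    simp [or_comm]
  · intro a _ b
    simp only [List.mem_cons]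
    tauto
  · intro a _ b
    simp only [bind_val, ite_val, ops_val]
    split <;> simp [or_comm]

theorem system_holds_iff {cnt : Region k → ℕ} {L U : ℕ} {x : Var k → ℚ} :
    (∀ c ∈ (system cnt L U).val, c.Holds x) ↔ IsSolution cnt L U x := by
  have hT : ∀ T, (∑ v : Var k, if v.1 = T then x v else 0) = ∑ j, x (T, j) := fun T => by
    rw [Fintype.sum_prod_type, Finset.sum_eq_single T] <;> simp +contextual
  have hj : ∀ j, (∑ v : Var k, if v.2 = j then x v else 0) = ∑ T, x (T, j) := fun j => by
    rw [Fintype.sum_prod_type]; simp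
  constructor
  · intro h
    have h3 : ∀ v : Var k, 0 ≤ x v ∧ (v.2 ∉ v.1 → x v = 0) := fun v => by
      have := h _ (mem_system.2 (Or.inr ⟨v, rfl⟩))
      split at this
      · rw [holds_row_false] at this
        simp at this
        tauto
      · rw [holds_row_true] at this
        simp at this
        simp [this]
    refine ⟨fun T => ?_, fun j => ?_, fun j => ?_, fun v => (h3 v).1, fun T j => (h3 (T, j)).2⟩
    · have := h _ (mem_system.2 (Or.inl (Or.inl ⟨T, rfl⟩)))
      rwa [holds_row_true, hT, one_mul] at this
    · have := h _ (mem_system.2 (Or.inl (Or.inr ⟨j, Or.inr rfl⟩)))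
      rw [holds_row_false, hj] at this
      linarith
    · have := h _ (mem_system.2 (Or.inl (Or.inr ⟨j, Or.inl rfl⟩)))
      rwa [holds_row_false, hj, one_mul] at this
  · intro h c hc
    rcases mem_system.1 hc with (⟨T, rfl⟩ | ⟨j, rfl | rfl⟩) | ⟨⟨T, j⟩, rfl⟩
    · rw [holds_row_true, hT, one_mul, h.sum_region]
    · rw [holds_row_false, hj, one_mul]; exact h.sum_cluster_le j
    · rw [holds_row_false, hj]; linarith [h.le_sum_cluster j]
    · split
      · rw [holds_row_false]
        simpa using h.nonneg (T, j)
      · rename_i hn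
        rw [holds_row_true]
        simpa using h.eq_zero T j hn

theorem solve_system_spec (cnt : Region k → ℕ) (L U : ℕ) :
    (∀ x, (solve (vars k) (system cnt L U).val).val = some x → IsSolution cnt L U x) ∧
      ((∃ x, IsSolution cnt L U x) → ∃ x, (solve (vars k) (system cnt L U).val).val = some x) := by
  simp only [← system_holds_iff]
  exact solve_spec _ _ fun c _ w hw => absurd (mem_vars w) hw

end

/-! ### Rounding -/

section

variable {k : ℕ}

/-- The variable `v` has a fractional value. -/
def IsFrac (x : Var k → ℚ) (v : Var k) : Prop := x v ≠ ⌊x v⌋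

instance (x : Var k → ℚ) : DecidablePred (IsFrac x) := fun v =>
  inferInstanceAs (Decidable (x v ≠ ⌊x v⌋))

theorem not_isFrac_iff {x : Var k → ℚ} {v : Var k} : ¬ IsFrac x v ↔ ∃ m : ℤ, x v = m := by
  rw [IsFrac, not_not]
  refine ⟨fun h => ⟨_, h⟩, fun ⟨m, h⟩ => by rw [h, Int.floor_intCast]⟩

@[simp] theorem isFrac_val (x : Var k → ℚ) (T : Region k) (j : Fin k) :
    (isFrac x T j).val = decide (IsFrac x (T, j)) := rfl

theorem fracDegree_val (x : Var k → ℚ) (j : Fin k) :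
    (fracDegree x j).val = (Finset.univ.filter fun T => IsFrac x (T, j)).card := by
  have h : ∀ (l : List (Region k)) (c : ℕ),
      l.foldl (fun c T => if IsFrac x (T, j) then c + 1 else c) c =
        c + (l.filter fun T => IsFrac x (T, j)).length := by
    intro l
    induction l with
    | nil => simp
    | cons T l ih => intro c; rw [List.foldl_cons, ih, List.filter_cons]; split <;> simp_all; ring
  have h2 : (Finset.univ.filter fun T => IsFrac x (T, j)) =
      ((regions k).filter fun T => IsFrac x (T, j)).toFinset := by
    ext T; simp [mem_regions]
  rw [h2, List.toFinset_card_of_nodup (regions_nodup.filter _)]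
  simp [fracDegree, h]

/-- A trail (latest edge first) from `s` to `v` through fractional variables, that uses no colour
twice. -/
inductive Trail (x : Var k → ℚ) (s : Fin k) : List (Edge k) → Fin k → Prop
  | nil : Trail x s [] s
  | cons {es : List (Edge k)} {v : Fin k} (T : Region k) (w : Fin k) : Trail x s es v → v ≠ w →
      IsFrac x (T, v) → IsFrac x (T, w) → (∀ e ∈ es, e.region ≠ T) → Trail x s (⟨v, T, w⟩ :: es) w

namespace Trail

variable {x : Var k → ℚ} {s v : Fin k} {es : List (Edge k)}

theorem edge (h : Trail x s es v) : ∀ e ∈ es, e.src ≠ e.dst ∧ IsFrac x (e.region, e.src) ∧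
    IsFrac x (e.region, e.dst) := by
  induction h with
  | nil => simp
  | cons T w _ h1 h2 h3 _ ih =>
    intro e he
    rcases List.mem_cons.1 he with rfl | he
    · exact ⟨h1, h2, h3⟩
    · exact ih e he

theorem isFrac_end (h : Trail x s es v) (hne : es ≠ []) : ∃ T, IsFrac x (T, v) := by
  cases h with
  | nil => exact absurd rfl hne
  | cons T w _ _ _ h3 _ => exact ⟨T, h3⟩

end Trail

/-! ### Cycles and paths through fractional values -/

theorem cut_val_cons (w : Fin k) (e : Edge k) (es : List (Edge k)) :
    (cut w (e :: es)).val = if e.src = w then [e] else e :: (cut w es).val := by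
  simp [cut]

theorem cut_subset (w : Fin k) (es : List (Edge k)) : (cut w es).val ⊆ es := by
  induction es with
  | nil => simp [cut]
  | cons e es ih =>
    rw [cut_val_cons]
    split
    · simp
    · exact List.cons_subset_cons _ ih

/-- The part from the latest departure from `w` onwards is again a trail; one more edge into `w`
turns it into a cycle. -/
theorem Trail.trail_cut {x : Var k → ℚ} {s v w : Fin k} {es : List (Edge k)} (h : Trail x s es v)
    (hw : w ∈ es.map Edge.src) : Trail x w (cut w es).val v := by
  induction h with
  | nil => simp at hw
  | @cons es u T v h h1 h2 h3 h4 ih =>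
    rw [cut_val_cons]
    split
    · rename_i huw
      subst huw
      exact .cons T v .nil h1 h2 h3 (by simp)
    · rename_i huw
      refine .cons T v (ih ?_) h1 h2 h3 fun e he => h4 e (cut_subset _ _ he)
      simpa [Ne.symm huw] using hw

/-- A colour of a trail, other than the last one, leads back to a ball at which the trail has been
after the use of this colour. -/
theorem Trail.cut_of_region_mem {x : Var k → ℚ} {s v : Fin k} {es : List (Edge k)}
    (h : Trail x s es v) {e : Edge k} (he : e ∈ es)
    (hhead : es.head?.map Edge.region ≠ some e.region) :
    e.dst ∈ es.map Edge.src ∧ ∀ e' ∈ (cut e.dst es).val, e'.region ≠ e.region := by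
  induction h with
  | nil => simp at he
  | @cons es u T v h h1 h2 h3 h4 ih =>
    have hT : T ≠ e.region := by simpa using hhead
    have he' : e ∈ es := by
      rcases List.mem_cons.1 he with rfl | he
      · exact absurd rfl hT
      · exact he
    rw [cut_val_cons]
    by_cases hu : u = e.dst
    · simp [hu, hT]
    -- If the shorter trail ended with the colour of `e`, its last edge would be `e`, as no colour
    -- occurs twice, and `u` would be `e.dst`.
    · have hh : es.head?.map Edge.region ≠ some e.region := by
        cases h with
        | nil => simp
        | @cons es u' T' _ h _ _ _ h5 =>
          intro hT'
          simp only [List.head?_cons, Option.map_some, Option.some.injEq] at hT'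
          rcases List.mem_cons.1 he' with rfl | he
          · exact hu rfl
          · exact h5 e he hT'.symm
      obtain ⟨i1, i2⟩ := ih he' hh
      refine ⟨List.mem_cons_of_mem _ i1, ?_⟩
      simp only [hu, if_false, List.mem_cons]
      rintro e' (rfl | he')
      · exact hT
      · exact i2 e' he'

/-- The walk ends with a cycle, or with a path into a ball that has only one fractional value. -/
theorem walk_spec {x : Var k → ℚ}
    (hx : ∀ T v, IsFrac x (T, v) → ∃ w, w ≠ v ∧ IsFrac x (T, w)) {s : Fin k} (f : ℕ)
    (trail : List (Edge k)) (v : Fin k) (ht : Trail x s trail v)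
    (hn : (v :: trail.map Edge.src).Nodup) (hf : f + trail.length = k + 1)
    (hv : trail = [] → ∃ T, IsFrac x (T, v)) :
    (walk x f trail v).val ≠ [] ∧ ∃ s' v', Trail x s' (walk x f trail v).val v' ∧
      (s' = v' ∨ s' = s ∧ ∀ T T', IsFrac x (T, v') → IsFrac x (T', v') → T = T') := by
  induction f generalizing trail v with
  | zero =>
    -- The recursion depth cannot run out: the current ball and the sources on the trail would be `k
    -- + 2` distinct balls.
    have := hn.length_le_card
    simp at this
    omega
  | succ f ih =>
    simp only [walk, bind_val, findFirst_val, ops_val, isFrac_val]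
    cases hT : (regions k).find? fun T => decide (IsFrac x (T, v)) &&
        decide (trail.head?.map Edge.region ≠ some T) with
    | none =>
      have hnone : ∀ T, IsFrac x (T, v) → trail.head?.map Edge.region = some T := fun T h => by
        simpa [h] using List.find?_eq_none.1 hT T (mem_regions T)
      have hne : trail ≠ [] := by
        rintro rfl
        obtain ⟨T, h⟩ := hv rfl
        simpa using hnone T h
      -- Stuck: every fractional value of `v` has the colour of the last edge, so there is only one.
      refine ⟨hne, s, v, ht, Or.inr ⟨rfl, fun T T' h h' => ?_⟩⟩
      exact Option.some.inj ((hnone T h).symm.trans (hnone T' h'))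
    | some T =>
      have hTp := List.find?_some hT
      simp only [Bool.and_eq_true, decide_eq_true_eq] at hTp
      obtain ⟨hTv, hhead⟩ := hTp
      simp only [bind_val, findFirst_val, ops_val]
      cases he : trail.find? fun e => decide (e.region = T) with
      | some e =>
        have hem := List.mem_of_find?_eq_some he
        have heT : e.region = T := by simpa using List.find?_some he
        subst heT
        obtain ⟨h1, h2⟩ := ht.cut_of_region_mem hem hhead
        simp only [bind_val, findFirst_val, ops_val]
        cases hb : trail.find? fun e' => decide (e'.src = e.dst) with
        | none =>
          obtain ⟨e', he', hs⟩ := List.mem_map.1 h1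
          have := List.find?_eq_none.1 hb e' he'
          simp [hs] at this
        | some _ =>
          -- The colour was used by `e`. Going from `v` straight back to the end of `e` closes a
          -- cycle that leaves out `e`, so the colour still occurs only once.
          refine ⟨by simp, e.dst, e.dst, ?_, Or.inl rfl⟩
          refine .cons _ _ (ht.trail_cut h1) ?_ hTv (ht.edge e hem).2.2 h2
          rintro rfl
          exact (List.nodup_cons.1 hn).1 h1
      | none =>
        have hfresh : ∀ e ∈ trail, e.region ≠ T := fun e h => by
          simpa using List.find?_eq_none.1 he e h
        simp only [findFirst_val, bind_val, ops_val, isFrac_val]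
        cases hw : (List.finRange k).find? fun w => decide (IsFrac x (T, w)) &&
            decide (w ≠ v) with
        | none =>
          obtain ⟨w, hwv, hTw⟩ := hx T v hTv
          have := List.find?_eq_none.1 hw w (List.mem_finRange w)
          simp [hwv, hTw] at this
        | some w =>
          have hwp := List.find?_some hw
          simp only [Bool.and_eq_true, decide_eq_true_eq] at hwp
          obtain ⟨hTw, hwv⟩ := hwp
          simp only [bind_val, findFirst_val, ops_val]
          cases hb : trail.find? fun e' => decide (e'.src = w) with
          | some e' =>
            have hm : w ∈ trail.map Edge.src := List.mem_map.2
              ⟨e', List.mem_of_find?_eq_some hb, by simpa using List.find?_some hb⟩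
            exact ⟨by simp, w, w, .cons _ _ (ht.trail_cut hm) hwv.symm hTv hTw fun e h =>
              hfresh e (cut_subset _ _ h), Or.inl rfl⟩
          | none =>
            have hm : w ∉ trail.map Edge.src := fun h => by
              obtain ⟨e', he', hs⟩ := List.mem_map.1 h
              have := List.find?_eq_none.1 hb e' he'
              simp [hs] at this
            refine ih _ w (.cons _ _ ht hwv.symm hTv hTw hfresh) ?_ ?_ (by simp)
            · rw [List.nodup_cons]
              exact ⟨by simpa [hwv] using hm, hn⟩
            · change f + (trail.length + 1) = k + 1; omega

/-- The net number of edges that raise the variable `v`. -/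
def flow (es : List (Edge k)) (v : Var k) : ℚ :=
  (es.map fun e => (if (e.region, e.dst) = v then 1 else 0) -
    (if (e.region, e.src) = v then 1 else 0)).sum

/-! ### Shifting values along a trail -/

theorem flow_cons (e : Edge k) (es : List (Edge k)) (v : Var k) : flow (e :: es) v =
    (if (e.region, e.dst) = v then 1 else 0) - (if (e.region, e.src) = v then 1 else 0) +
      flow es v := by
  simp [flow]

/-- Both ends of an edge are variables of the same region, so its contributions cancel. -/
theorem sum_flow_region (es : List (Edge k)) (T : Region k) : ∑ j, flow es (T, j) = 0 := by
  induction es with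
  | nil => simp [flow]
  | cons e es ih =>
    simp only [flow_cons, Finset.sum_add_distrib, ih, Finset.sum_sub_distrib, Prod.mk.injEq,
      ite_and]
    simp

/-- Telescoping: an inner ball is left as often as it is entered. For a cycle nothing remains. -/
theorem Trail.sum_flow_cluster {x : Var k → ℚ} {s v : Fin k} {es : List (Edge k)}
    (h : Trail x s es v) (j : Fin k) :
    ∑ T, flow es (T, j) = (if v = j then 1 else 0) - if s = j then 1 else 0 := by
  induction h with
  | nil => simp [flow]
  | cons T w _ _ _ _ _ ih =>
    simp only [flow_cons, Finset.sum_add_distrib, ih, Finset.sum_sub_distrib, Prod.mk.injEq]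
    have h : ∀ u : Fin k, ∑ T', (if T = T' ∧ u = j then (1 : ℚ) else 0) =
        if u = j then 1 else 0 := fun u => by
      by_cases hu : u = j <;> simp [hu]
    rw [h, h]
    ring

theorem flow_eq_zero {es : List (Edge k)} {v : Var k} (h : ∀ e ∈ es, e.region ≠ v.1) :
    flow es v = 0 := by
  induction es with
  | nil => simp [flow]
  | cons e es ih =>
    have he := h e (by simp)
    rw [flow_cons, ih fun e' he' => h e' (by simp [he'])]
    rw [if_neg fun h => he (congrArg Prod.fst h), if_neg fun h => he (congrArg Prod.fst h)]
    simp

/-- No colour occurs twice, so within a region only one edge acts. Every variable therefore moves at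
most once, which makes the step length of `shift` safe. -/
theorem Trail.flow_of_mem {x : Var k → ℚ} {s v : Fin k} {es : List (Edge k)}
    (h : Trail x s es v) {e : Edge k} (he : e ∈ es) (j : Fin k) :
    flow es (e.region, j) = (if e.dst = j then 1 else 0) - if e.src = j then 1 else 0 := by
  induction h with
  | nil => simp at he
  | cons T w _ _ _ _ h4 ih =>
    rw [flow_cons]
    rcases List.mem_cons.1 he with rfl | he
    · rw [flow_eq_zero h4]
      simp
    · rw [ih he, if_neg fun h => h4 e he (congrArg Prod.fst h).symm,
        if_neg fun h => h4 e he (congrArg Prod.fst h).symm]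
      ring

/-- The amount by which `adjust` shifts. -/
def shift (x : Var k → ℚ) (es : List (Edge k)) : ℚ :=
  es.foldl (fun acc e => min acc (min (x (e.region, e.src) - ⌊x (e.region, e.src)⌋)
    (⌈x (e.region, e.dst)⌉ - x (e.region, e.dst)))) 1

theorem adjust_val (x : Var k → ℚ) (es : List (Edge k)) (v : Var k) :
    (adjust x es).val v = x v + shift x es * flow es v := by
  have h : ∀ (δ : ℚ) (l : List (Edge k)) (y : Var k → ℚ), l.foldl (fun y e =>
      Function.update (Function.update y (e.region, e.src) (y (e.region, e.src) - δ))
        (e.region, e.dst) (Function.update y (e.region, e.src) (y (e.region, e.src) - δ)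
          (e.region, e.dst) + δ)) y v = y v + δ * flow l v := by
    intro δ l
    induction l with
    | nil => simp [flow]
    | cons e l ih =>
      intro y
      rw [List.foldl_cons, ih, flow_cons]
      simp only [Function.update_apply, @eq_comm _ v]
      split_ifs <;> simp_all <;> ring
  simp only [adjust, bind_val, forEach_val, ops_val]
  exact h _ _ _

theorem shift_spec (x : Var k → ℚ) (es : List (Edge k)) :
    (∀ e ∈ es, shift x es ≤ x (e.region, e.src) - ⌊x (e.region, e.src)⌋ ∧
      shift x es ≤ ⌈x (e.region, e.dst)⌉ - x (e.region, e.dst)) ∧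
    (shift x es = 1 ∨ ∃ e ∈ es, shift x es = x (e.region, e.src) - ⌊x (e.region, e.src)⌋ ∨
      shift x es = ⌈x (e.region, e.dst)⌉ - x (e.region, e.dst)) := by
  refine foldl_prefix_induction (p := fun (es : List (Edge k)) (δ : ℚ) =>
    (∀ e ∈ es, δ ≤ x (e.region, e.src) - ⌊x (e.region, e.src)⌋ ∧
      δ ≤ ⌈x (e.region, e.dst)⌉ - x (e.region, e.dst)) ∧
    (δ = 1 ∨ ∃ e ∈ es, δ = x (e.region, e.src) - ⌊x (e.region, e.src)⌋ ∨
      δ = ⌈x (e.region, e.dst)⌉ - x (e.region, e.dst))) (by simp) ?_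
  rintro l₁ e l₂ δ - ⟨h1, h2⟩
  constructor
  · intro e' he'
    rcases List.mem_append.1 he' with he' | he'
    · exact ⟨(min_le_left _ _).trans (h1 e' he').1, (min_le_left _ _).trans (h1 e' he').2⟩
    · obtain rfl := List.mem_singleton.1 he'
      exact ⟨(min_le_right _ _).trans (min_le_left _ _),
        (min_le_right _ _).trans (min_le_right _ _)⟩
  · rcases min_choice δ (min (x (e.region, e.src) - ⌊x (e.region, e.src)⌋)
      (⌈x (e.region, e.dst)⌉ - x (e.region, e.dst))) with h | h
    · rw [h]
      refine h2.imp_right ?_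
      rintro ⟨e', he', h⟩
      exact ⟨e', by simp [he'], h⟩
    · rw [h]
      exact Or.inr ⟨e, by simp, min_choice _ _⟩

theorem shift_nonneg (x : Var k → ℚ) (es : List (Edge k)) : 0 ≤ shift x es := by
  rcases (shift_spec x es).2 with h1 | ⟨e, he, h1 | h1⟩
  · rw [h1]; exact zero_le_one
  · rw [h1]; exact sub_nonneg.2 (Int.floor_le _)
  · rw [h1]; exact sub_nonneg.2 (Int.le_ceil _)

/-- The one edge that can move `w` bounds the shift by the distance from `x w` to the next integer
in its direction. In particular integral values do not move. -/
theorem Trail.adjust_mem_Icc {x : Var k → ℚ} {s v : Fin k} {es : List (Edge k)}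
    (h : Trail x s es v) (w : Var k) :
    (⌊x w⌋ : ℚ) ≤ (adjust x es).val w ∧ (adjust x es).val w ≤ ⌈x w⌉ := by
  have hf := Int.floor_le (x w)
  have hc := Int.le_ceil (x w)
  rw [adjust_val]
  by_cases hw : ∀ e ∈ es, e.region ≠ w.1
  · rw [flow_eq_zero hw, mul_zero, add_zero]
    exact ⟨hf, hc⟩
  · push Not at hw
    obtain ⟨e, he, hew⟩ := hw
    obtain ⟨T, j⟩ := w
    obtain rfl : e.region = T := hew
    have hs := (shift_spec x es).1 e he
    have hδ := shift_nonneg x es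
    rw [h.flow_of_mem he]
    split_ifs with h1 h2 h2
    · exact absurd (h2.trans h1.symm) (h.edge e he).1
    · subst h1
      constructor <;> linarith [hs.2]
    · subst h2
      constructor <;> linarith [hs.1]
    · constructor <;> linarith

/-- The variable that limits the shift lands on an integer. -/
theorem Trail.exists_adjust_integral {x : Var k → ℚ} {s v : Fin k} {es : List (Edge k)}
    (h : Trail x s es v) (hne : es ≠ []) :
    ∃ w, IsFrac x w ∧ ¬ IsFrac (adjust x es).val w := by
  obtain ⟨e, he, heq⟩ : ∃ e ∈ es, shift x es = x (e.region, e.src) - ⌊x (e.region, e.src)⌋ ∨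
      shift x es = ⌈x (e.region, e.dst)⌉ - x (e.region, e.dst) := by
    -- The initial value `1` of the minimum is never the result on a nonempty trail, because a value
    -- exceeds its floor by less than `1`.
    refine (shift_spec x es).2.resolve_left fun h1 => ?_
    obtain ⟨e, he⟩ := List.exists_mem_of_ne_nil es hne
    have := ((shift_spec x es).1 e he).1
    linarith [Int.lt_floor_add_one (x (e.region, e.src))]
  obtain ⟨h1, h2, h3⟩ := h.edge e he
  rcases heq with heq | heq
  · refine ⟨_, h2, not_isFrac_iff.2 ⟨⌊x (e.region, e.src)⌋, ?_⟩⟩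
    rw [adjust_val, h.flow_of_mem he, heq, if_neg h1.symm, if_pos rfl]
    ring
  · refine ⟨_, h3, not_isFrac_iff.2 ⟨⌈x (e.region, e.dst)⌉, ?_⟩⟩
    rw [adjust_val, h.flow_of_mem he, heq, if_pos rfl, if_neg h1]
    ring

theorem exists_sum_eq_intCast {ι : Type} (s : Finset ι) (f : ι → ℚ)
    (h : ∀ i ∈ s, ∃ m : ℤ, f i = m) : ∃ m : ℤ, ∑ i ∈ s, f i = m := by
  choose! g hg using h
  exact ⟨∑ i ∈ s, g i, by push_cast; exact Finset.sum_congr rfl hg⟩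

/-- An adjustment keeps a solution a solution, if the trail is a cycle or joins two balls with at
most one fractional value each. -/
theorem isSolution_adjust {cnt : Region k → ℕ} {L U : ℕ} {x : Var k → ℚ}
    (hx : IsSolution cnt L U x) {s v : Fin k} {es : List (Edge k)} (h : Trail x s es v)
    (hsv : s = v ∨ ∀ j, j = s ∨ j = v → ∀ T T', IsFrac x (T, j) → IsFrac x (T', j) → T = T') :
    IsSolution cnt L U (adjust x es).val := by
  have hint : ∀ w, ¬ IsFrac x w → (adjust x es).val w = x w := fun w hw => by
    obtain ⟨m, hm⟩ := not_isFrac_iff.1 hw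
    have := h.adjust_mem_Icc w
    rw [hm, Int.floor_intCast, Int.ceil_intCast] at this
    rw [hm]
    exact le_antisymm this.2 this.1
  have hcl : ∀ j, (L : ℚ) ≤ ∑ T, (adjust x es).val (T, j) ∧
      ∑ T, (adjust x es).val (T, j) ≤ U := by
    intro j
    have hL := hx.le_sum_cluster j
    have hU := hx.sum_cluster_le j
    by_cases hj : ∑ T, flow es (T, j) = 0
    · simp only [adjust_val, Finset.sum_add_distrib, ← Finset.mul_sum, hj]
      constructor <;> linarith
    · rw [h.sum_flow_cluster] at hj
      -- A cluster total with nonzero flow belongs to an end of an open path, where the fractional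
      -- value is unique.
      have huniq : ∀ T T', IsFrac x (T, j) → IsFrac x (T', j) → T = T' := by
        rcases hsv with rfl | hsv
        · simp at hj
        · refine hsv j ?_
          by_contra! hcon
          simp [hcon.1.symm, hcon.2.symm] at hj
      by_cases hex : ∃ T, IsFrac x (T, j)
      · obtain ⟨T, hT⟩ := hex
        have hoth : ∀ T' ∈ Finset.univ.erase T, ¬ IsFrac x (T', j) := fun T' hT' h =>
          Finset.ne_of_mem_erase hT' (huniq _ _ h hT)
        obtain ⟨m, hm⟩ := exists_sum_eq_intCast (Finset.univ.erase T) (fun T' => x (T', j))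
          fun T' hT' => not_isFrac_iff.1 (hoth T' hT')
        have hm' : ∑ T' ∈ Finset.univ.erase T, (adjust x es).val (T', j) = m := by
          rw [← hm]
          exact Finset.sum_congr rfl fun T' hT' => hint _ (hoth T' hT')
        rw [← Finset.sum_erase_add _ _ (Finset.mem_univ T), hm] at hL hU
        rw [← Finset.sum_erase_add _ _ (Finset.mem_univ T), hm']
        have hI := h.adjust_mem_Icc (T, j)
        -- The other values of the cluster add up to the integer `m`. The bounds on `x (T, j)` thus
        -- have integer ends and pass to its floor and ceiling, between which the new value lies.
        have h1 : (L : ℤ) - m ≤ ⌊x (T, j)⌋ := Int.le_floor.2 (by push_cast; linarith)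
        have h2 : ⌈x (T, j)⌉ ≤ (U : ℤ) - m := Int.ceil_le.2 (by push_cast; linarith)
        have h1' : (L : ℚ) - m ≤ ⌊x (T, j)⌋ := by exact_mod_cast h1
        have h2' : (⌈x (T, j)⌉ : ℚ) ≤ U - m := by exact_mod_cast h2
        constructor <;> linarith
      · push Not at hex
        simp only [hint _ (hex _)]
        exact ⟨hL, hU⟩
  refine ⟨fun T => ?_, fun j => (hcl j).1, fun j => (hcl j).2, fun w => ?_, fun T j hj => ?_⟩
  · simp only [adjust_val, Finset.sum_add_distrib, ← Finset.mul_sum, sum_flow_region, hx.sum_region]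
    ring
  · refine le_trans ?_ (h.adjust_mem_Icc w).1
    exact_mod_cast Int.floor_nonneg.2 (hx.nonneg w)
  · have h0 := hx.eq_zero T j hj
    rw [hint _ (not_isFrac_iff.2 ⟨0, by simpa using h0⟩), h0]

/-- The fractional variables. -/
def fracVars (x : Var k → ℚ) : Finset (Var k) := Finset.univ.filter (IsFrac x)

theorem Trail.fracVars_adjust_ssubset {x : Var k → ℚ} {s v : Fin k} {es : List (Edge k)}
    (h : Trail x s es v) (hne : es ≠ []) : fracVars (adjust x es).val ⊂ fracVars x := by
  refine Finset.ssubset_iff_subset_ne.2 ⟨fun w hw => ?_, fun heq => ?_⟩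
  · simp only [fracVars, Finset.mem_filter, Finset.mem_univ, true_and] at hw ⊢
    by_contra hcon
    obtain ⟨m, hm⟩ := not_isFrac_iff.1 hcon
    have := h.adjust_mem_Icc w
    rw [hm, Int.floor_intCast, Int.ceil_intCast] at this
    exact not_isFrac_iff.2 ⟨m, le_antisymm this.2 this.1⟩ hw
  · obtain ⟨w, h1, h2⟩ := h.exists_adjust_integral hne
    have := Finset.ext_iff.1 heq w
    simp [fracVars, h1, h2] at this

/-- A path that starts in a leaf gets stuck only in a leaf, so both ends are harmless. If there is
no leaf, the walk cannot get stuck and must close a cycle. The truncated subtraction covers an `x`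
that is already integral. -/
theorem isSolution_roundStep {cnt : Region k → ℕ} {L U : ℕ} {x : Var k → ℚ}
    (hx : IsSolution cnt L U x) : IsSolution cnt L U (roundStep x).val ∧
      (fracVars (roundStep x).val).card ≤ (fracVars x).card - 1 := by
  -- A single fractional value would contradict the integral sum of its region.
  have hpartner : ∀ T v, IsFrac x (T, v) → ∃ w, w ≠ v ∧ IsFrac x (T, w) := by
    intro T v hTv
    by_contra! hcon
    obtain ⟨m, hm⟩ := exists_sum_eq_intCast (Finset.univ.erase v) (fun w => x (T, w))
      fun w hw => not_isFrac_iff.1 (hcon w (Finset.ne_of_mem_erase hw))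
    have hsum := hx.sum_region T
    rw [← Finset.sum_erase_add _ _ (Finset.mem_univ v), hm] at hsum
    refine not_isFrac_iff.2 ⟨cnt T - m, ?_⟩ hTv
    push_cast
    linarith
  have hwalk : ∀ j, (∃ T, IsFrac x (T, j)) → ((∀ v, (fracDegree x v).val ≠ 1) ∨
      ∀ T T', IsFrac x (T, j) → IsFrac x (T', j) → T = T') →
      IsSolution cnt L U (adjust x (walk x (k + 1) [] j).val).val ∧
      (fracVars (adjust x (walk x (k + 1) [] j).val).val).card ≤ (fracVars x).card - 1 := by
    intro j hj hleaf
    obtain ⟨hne, s, v, ht, hend⟩ := walk_spec hpartner (k + 1) [] j .nil (by simp) (by simp)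
      fun _ => hj
    refine ⟨isSolution_adjust hx ht ?_, Nat.le_sub_one_of_lt
      (Finset.card_lt_card (ht.fracVars_adjust_ssubset hne))⟩
    rcases hend with hend | ⟨rfl, hv⟩
    · exact Or.inl hend
    · refine Or.inr ?_
      rcases hleaf with hleaf | hleaf
      · exfalso
        refine hleaf v ?_
        rw [fracDegree_val, Finset.card_eq_one]
        obtain ⟨T, hT⟩ := ht.isFrac_end hne
        refine ⟨T, Finset.eq_singleton_iff_unique_mem.2 ⟨by simpa using hT, fun T' hT' => ?_⟩⟩
        exact hv _ _ (by simpa using hT') hT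
      · rintro i (rfl | rfl)
        · exact hleaf
        · exact hv
  simp only [roundStep, bind_val, findFirst_val, ops_val]
  cases h1 : (List.finRange k).find? fun j => decide ((fracDegree x j).val = 1) with
  | some j =>
    have hj : (fracDegree x j).val = 1 := by simpa using List.find?_some h1
    rw [fracDegree_val, Finset.card_eq_one] at hj
    obtain ⟨T, hT⟩ := hj
    have hmem : ∀ T', IsFrac x (T', j) ↔ T' = T := fun T' => by
      simpa using Finset.ext_iff.1 hT T'
    simp only [ops_val, bind_val]
    exact hwalk j ⟨T, (hmem T).2 rfl⟩ (Or.inr fun T1 T2 h1 h2 =>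
      ((hmem T1).1 h1).trans ((hmem T2).1 h2).symm)
  | none =>
    simp only [findFirst_val, bind_val, ops_val]
    cases h2 : (List.finRange k).find? fun j => decide (0 < (fracDegree x j).val) with
    | some j =>
      have hj : 0 < (fracDegree x j).val := by simpa using List.find?_some h2
      rw [fracDegree_val, Finset.card_pos] at hj
      obtain ⟨T, hT⟩ := hj
      simp only [bind_val]
      refine hwalk j ⟨T, by simpa using hT⟩ (Or.inl fun v => ?_)
      simpa using List.find?_eq_none.1 h1 v (List.mem_finRange v)
    | none =>
      refine ⟨hx, ?_⟩
      have : fracVars x = ∅ := by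
        refine Finset.eq_empty_iff_forall_notMem.2 fun ⟨T, j⟩ hw => ?_
        have h3 := List.find?_eq_none.1 h2 j (List.mem_finRange j)
        simp only [fracDegree_val, decide_eq_true_eq, Finset.card_pos,
          Finset.not_nonempty_iff_eq_empty] at h3
        have := Finset.ext_iff.1 h3 T
        simp only [Finset.mem_filter, Finset.mem_univ, true_and, Finset.notMem_empty,
          iff_false] at this
        exact this (by simpa [fracVars] using hw)
      simp [this]

/-- There are at most as many fractional variables as rounds of the loop, and each round removes one
while any remain. -/
theorem isSolution_roundSolution {cnt : Region k → ℕ} {L U : ℕ} {x : Var k → ℚ}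
    (hx : IsSolution cnt L U x) : IsSolution cnt L U (roundSolution x).val ∧
      ∀ v, ¬ IsFrac (roundSolution x).val v := by
  have key : IsSolution cnt L U (roundSolution x).val ∧
      (fracVars (roundSolution x).val).card ≤
        (fracVars x).card - (vars k).length := by
    rw [roundSolution, forEach_val]
    refine foldl_prefix_induction (p := fun (l : List (Var k)) y => IsSolution cnt L U y ∧
      (fracVars y).card ≤ (fracVars x).card - l.length) ⟨hx, by simp⟩ ?_
    rintro l₁ v l₂ y - ⟨h1, h2⟩
    obtain ⟨h3, h4⟩ := isSolution_roundStep h1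
    refine ⟨h3, ?_⟩
    rw [List.length_append, List.length_singleton]
    omega
  refine ⟨key.1, fun v hv => ?_⟩
  have hcard : (fracVars x).card ≤ (vars k).length := by
    rw [← List.toFinset_card_of_nodup (vars_nodup (k := k)), toFinset_vars]
    exact Finset.card_le_univ _
  have : v ∈ fracVars (roundSolution x).val := by simpa [fracVars] using hv
  have := Finset.card_pos.2 ⟨v, this⟩
  omega

end

/-! ### Distribution and binary search -/

section

variable {n d k : ℕ}

theorem regionOf_val (D : Fin n → Fin k → ℝ) (t : Fin k → Fin k) (r : ℝ) (i : Fin n) :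
    (regionOf D t r i).val = Finset.univ.filter fun j => D i (t j) ≤ r := by
  have h : ∀ (l : List (Fin k)) (T : Region k),
      l.foldl (fun T j => if D i (t j) ≤ r then insert j T else T) T =
        T ∪ (l.filter fun j => D i (t j) ≤ r).toFinset := by
    intro l
    induction l with
    | nil => simp
    | cons a l ih =>
      intro T
      by_cases h : D i (t a) ≤ r <;> simp [h, ih, Finset.insert_union, Finset.union_insert]
  simp only [regionOf, forEach_val, ops_val, h]
  ext; simp

theorem mem_allRegions {D : Fin n → Fin k → ℝ} {t : Fin k → Fin k} {r : ℝ} {i : Fin n}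
    {j : Fin k} : j ∈ (allRegions D t r).val i ↔ D i (t j) ≤ r := by
  simp [allRegions, regionOf_val]

theorem countIn_val (reg : Fin n → Region k) (T : Region k) :
    (countIn reg T).val = (Finset.univ.filter fun i => reg i = T).card := by
  have h : ∀ (l : List (Fin n)) (c : ℕ), l.foldl (fun c i => if reg i = T then c + 1 else c) c =
      c + (l.filter fun i => reg i = T).length := by
    intro l
    induction l with
    | nil => simp
    | cons a l ih => intro c; rw [List.foldl_cons, ih, List.filter_cons]; split <;> simp_all; ring
  have h2 : (Finset.univ.filter fun i => reg i = T) =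
      ((List.finRange n).filter fun i => reg i = T).toFinset := by
    ext; simp
  rw [h2, List.toFinset_card_of_nodup ((List.nodup_finRange n).filter _)]
  simp [countIn, h]

theorem card_filter_univ_eq_countP (p : Fin n → Prop) [DecidablePred p] :
    (Finset.univ.filter p).card = (List.finRange n).countP p := by
  have h2 : Finset.univ.filter p = ((List.finRange n).filter p).toFinset := by
    ext; simp
  rw [h2, List.toFinset_card_of_nodup ((List.nodup_finRange n).filter _),
    List.countP_eq_length_filter]

/-- The invariant of `distribute` after the points of `l`: `q` says how many points of every region
still have to go to every cluster, `a` is the assignment so far. -/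
structure DistributeInv (reg : Fin n → Region k) (q₀ : Var k → ℕ) (l : List (Fin n))
    (st : (Var k → ℕ) × (Fin n → Fin k)) : Prop where
  region : ∀ T, ∑ j, st.1 (T, j) + l.countP (fun i => reg i = T) = ∑ j, q₀ (T, j)
  cluster : ∀ j, ∑ T, st.1 (T, j) + l.countP (fun i => st.2 i = j) = ∑ T, q₀ (T, j)
  eq_zero : ∀ T j, j ∉ T → st.1 (T, j) = 0
  mem : ∀ i ∈ l, st.2 i ∈ reg i

/-- Serves the row sums and the column sums of the quotas alike, `g` running through a row or a
column. The additive form avoids truncated subtraction of sums. -/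
theorem sum_update_sub_one {ι κ : Type} [Fintype ι] [DecidableEq κ] (q : κ → ℕ) (v : κ)
    (hv : 0 < q v) (g : ι → κ) (hg : Function.Injective g) [Decidable (v ∈ Set.range g)] :
    ∑ i, Function.update q v (q v - 1) (g i) + (if v ∈ Set.range g then 1 else 0) =
      ∑ i, q (g i) := by
  classical
  split
  · rename_i h
    obtain ⟨i, rfl⟩ := h
    rw [← Finset.sum_erase_add _ _ (Finset.mem_univ i),
      ← Finset.sum_erase_add Finset.univ (fun i => q (g i)) (Finset.mem_univ i),
      Finset.sum_congr rfl fun j hj => Function.update_of_ne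
        (fun h => Finset.ne_of_mem_erase hj (hg h)) _ _, Function.update_self]
    omega
  · rename_i h
    rw [add_zero]
    exact Finset.sum_congr rfl fun j _ => Function.update_of_ne (fun h' => h ⟨j, h'⟩) _ _

/-- The quotas of a region add up to the number of its points, so they never run out early and are
all used up at the end. The size of a cluster is then the sum of its quotas, which lies between `L`
and `U`. -/
theorem distribute_spec [NeZero k] (reg : Fin n → Region k) {L U : ℕ} {x : Var k → ℚ}
    (hx : IsSolution (fun T => (Finset.univ.filter fun i => reg i = T).card) L U x)
    (hint : ∀ v, ¬ IsFrac x v) :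
    (∀ i, (distribute reg x).val i ∈ reg i) ∧
      ∀ j, L ≤ (Finset.univ.filter fun i => (distribute reg x).val i = j).card ∧
        (Finset.univ.filter fun i => (distribute reg x).val i = j).card ≤ U := by
  set q₀ : Var k → ℕ := fun v => ⌊x v⌋₊ with hq₀
  have hq : ∀ v, (q₀ v : ℚ) = x v := fun v => by
    obtain ⟨m, hm⟩ := not_isFrac_iff.1 (hint v)
    have h0 := hx.nonneg v
    rw [hm] at h0
    obtain ⟨m, rfl⟩ := Int.eq_ofNat_of_zero_le (Int.cast_nonneg_iff.1 h0)
    simp [hq₀, hm]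
  have hreg : ∀ T, ∑ j, q₀ (T, j) = (List.finRange n).countP fun i => reg i = T := fun T => by
    have := hx.sum_region T
    rw [← card_filter_univ_eq_countP]
    simp only [← hq] at this
    exact_mod_cast this
  have key : DistributeInv reg q₀ (List.finRange n) ((List.finRange n).foldl
      (fun (st : (Var k → ℕ) × (Fin n → Fin k)) i =>
        match (List.finRange k).find? fun j => decide (0 < st.1 (reg i, j)) with
        | none => st
        | some j => (Function.update st.1 (reg i, j) (st.1 (reg i, j) - 1),
            Function.update st.2 i j)) (q₀, fun _ => 0)) := by
    refine foldl_prefix_induction (p := DistributeInv reg q₀) ⟨by simp, by simp, ?_, by simp⟩ ?_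
    · intro T j hj
      have := hq (T, j)
      rw [hx.eq_zero T j hj] at this
      exact_mod_cast this
    · rintro l₁ i l₂ ⟨q, a⟩ hl ⟨h1, h2, h3, h4⟩
      simp only at h1 h2 h3 h4
      cases hfind : (List.finRange k).find? fun j => decide (0 < q (reg i, j)) with
      | none =>
        -- With no quota left, the earlier points of the region of `i` would already be all its
        -- points, although `i` is still to come.
        exfalso
        have hz : ∑ j, q (reg i, j) = 0 := Finset.sum_eq_zero fun j _ => by
          simpa using List.find?_eq_none.1 hfind j (List.mem_finRange j)
        have := h1 (reg i)
        rw [hz, hreg, hl] at this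
        simp at this
      | some j =>
        dsimp only
        have hj : 0 < q (reg i, j) := by simpa using List.find?_some hfind
        have hi : i ∉ l₁ := fun hi => by
          have := List.nodup_finRange n
          rw [hl] at this
          exact (List.nodup_append.1 this).2.2 i hi i (by simp) rfl
        -- The write concerns a point not yet treated and leaves the earlier counts alone.
        have ha : ∀ j', l₁.countP (fun i' => Function.update a i j i' = j') =
            l₁.countP (fun i' => a i' = j') := fun j' => by
          refine List.countP_congr fun i' hi' => ?_
          rw [Function.update_of_ne]
          rintro rfl; exact hi hi'
        refine ⟨fun T => ?_, fun j' => ?_, fun T j' hj' => ?_, fun i' hi' => ?_⟩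
        · have hs := sum_update_sub_one q (reg i, j) hj (fun j' => (T, j'))
            (fun _ _ h => congrArg Prod.snd h)
          simp only [Set.mem_range, Prod.mk.injEq, exists_eq_right, @eq_comm _ T] at hs
          rw [← h1 T, ← hs, List.countP_append]
          by_cases hT : reg i = T
          · simp [hT]; omega
          · simp [hT]
        · have hs := sum_update_sub_one q (reg i, j) hj (fun T => (T, j'))
            (fun _ _ h => congrArg Prod.fst h)
          simp only [Set.mem_range, Prod.mk.injEq, exists_eq_left, @eq_comm _ j'] at hs
          rw [← h2 j', ← hs, List.countP_append, ha]
          by_cases hj' : j = j'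
          · simp [hj']; omega
          · simp [hj']
        · simp only [Function.update_apply]
          split
          · rename_i h
            rw [← h, h3 T j' hj']
          · exact h3 T j' hj'
        · dsimp only
          rcases List.mem_append.1 hi' with hi' | hi'
          · rw [Function.update_of_ne (ne_of_mem_of_not_mem hi' hi)]
            exact h4 i' hi'
          · obtain rfl := List.mem_singleton.1 hi'
            rw [Function.update_self]
            by_contra hcon
            exact hj.ne' (h3 _ _ hcon)
  have hval : (distribute reg x).val = ((List.finRange n).foldl
      (fun (st : (Var k → ℕ) × (Fin n → Fin k)) i =>
        match (List.finRange k).find? fun j => decide (0 < st.1 (reg i, j)) with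
        | none => st
        | some j => (Function.update st.1 (reg i, j) (st.1 (reg i, j) - 1),
            Function.update st.2 i j)) (q₀, fun _ => 0)).2 := by
    simp only [distribute, bind_val, forEach_val, tabulate_val, ops_val, pure_val, findFirst_val]
    congr 2
    funext st i
    rcases List.find? (fun j => decide (0 < st.1 (reg i, j))) (List.finRange k) <;> rfl
  generalize List.foldl _ _ (List.finRange n) = st at key hval
  obtain ⟨h1, h2, -, h4⟩ := key
  rw [hval]
  refine ⟨fun i => h4 i (List.mem_finRange i), fun j => ?_⟩
  have hz : ∀ T j, st.1 (T, j) = 0 := fun T j => by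
    have := h1 T
    rw [hreg] at this
    have := Finset.sum_eq_zero_iff.1 (Nat.add_eq_right.1 this) j (Finset.mem_univ j)
    exact this
  have hc := h2 j
  rw [Finset.sum_eq_zero fun T _ => hz T j, zero_add, ← card_filter_univ_eq_countP] at hc
  rw [hc]
  have hl := hx.le_sum_cluster j
  have hu := hx.sum_cluster_le j
  simp only [← hq] at hl hu
  exact ⟨by exact_mod_cast hl, by exact_mod_cast hu⟩

/-- The number of points in every region for the balls of radius `r` around the tuple `t`. -/
noncomputable def sizes (D : Fin n → Fin k → ℝ) (t : Fin k → Fin k) (r : ℝ) (T : Region k) : ℕ :=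
  (Finset.univ.filter fun i => (allRegions D t r).val i = T).card

/-- The points can be distributed to the balls of radius `r` around the tuple `t`. -/
def Feasible (D : Fin n → Fin k → ℝ) (L U : ℕ) (t : Fin k → Fin k) (r : ℝ) : Prop :=
  ∃ a : Fin n → Fin k, (∀ j, L ≤ (Finset.univ.filter fun i => a i = j).card ∧
    (Finset.univ.filter fun i => a i = j).card ≤ U) ∧ ∀ i, D i (t (a i)) ≤ r

theorem Feasible.mono {D : Fin n → Fin k → ℝ} {L U : ℕ} {t : Fin k → Fin k} {r r' : ℝ}
    (h : Feasible D L U t r) (hr : r ≤ r') : Feasible D L U t r' :=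
  let ⟨a, h1, h2⟩ := h
  ⟨a, h1, fun i => (h2 i).trans hr⟩

/-- Counting the points of an assignment by region and cluster gives the solution; the sums are
counts over fibers. -/
theorem Feasible.exists_isSolution {D : Fin n → Fin k → ℝ} {L U : ℕ} {t : Fin k → Fin k} {r : ℝ}
    (h : Feasible D L U t r) : ∃ x, IsSolution (sizes D t r) L U x := by
  obtain ⟨a, h1, h2⟩ := h
  refine ⟨fun v => (Finset.univ.filter fun i => (allRegions D t r).val i = v.1 ∧ a i = v.2).card,
    ?_⟩
  have hcl : ∀ j, ∑ T, (Finset.univ.filter fun i => (allRegions D t r).val i = T ∧ a i = j).card =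
      (Finset.univ.filter fun i => a i = j).card := fun j => by
    rw [Finset.card_eq_sum_card_fiberwise (f := (allRegions D t r).val) (t := Finset.univ)
      (by simp)]
    simp [Finset.filter_filter, and_comm]
  refine ⟨fun T => ?_, fun j => ?_, fun j => ?_, fun v => by positivity, fun T j hj => ?_⟩
  · rw [sizes, Finset.card_eq_sum_card_fiberwise (f := a) (t := Finset.univ) (by simp)]
    simp [Finset.filter_filter]
  · exact_mod_cast (hcl j).symm ▸ (h1 j).1
  · exact_mod_cast (hcl j).symm ▸ (h1 j).2
  · simp only [Nat.cast_eq_zero, Finset.card_eq_zero]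
    refine Finset.filter_eq_empty_iff.2 ?_
    rintro i - ⟨rfl, rfl⟩
    exact hj (mem_allRegions.2 (h2 i))

theorem round_distribute_spec [NeZero k] {D : Fin n → Fin k → ℝ} {L U : ℕ} {t : Fin k → Fin k}
    {r : ℝ} {x : Var k → ℚ} (hx : IsSolution (sizes D t r) L U x) :
    (∀ i, D i (t ((distribute (allRegions D t r).val (roundSolution x).val).val i)) ≤ r) ∧
      ∀ j, L ≤ (Finset.univ.filter fun i =>
        (distribute (allRegions D t r).val (roundSolution x).val).val i = j).card ∧
        (Finset.univ.filter fun i =>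
          (distribute (allRegions D t r).val (roundSolution x).val).val i = j).card ≤ U := by
  obtain ⟨h1, h2⟩ := isSolution_roundSolution hx
  obtain ⟨h3, h4⟩ := distribute_spec _ h1 h2
  exact ⟨fun i => mem_allRegions.1 (h3 i), h4⟩

theorem testRadius_spec (D : Fin n → Fin k → ℝ) (L U : ℕ) (t : Fin k → Fin k) (r : ℝ) :
    (∀ x, (testRadius D L U t r).val = some x → IsSolution (sizes D t r) L U x) ∧
      (Feasible D L U t r → ∃ x, (testRadius D L U t r).val = some x) := by
  have h : (testRadius D L U t r).val = (solve (vars k) (system (sizes D t r) L U).val).val := by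
    simp only [testRadius, bind_val, tabulate_val, countIn_val]
    rfl
  rw [h]
  obtain ⟨h1, h2⟩ := solve_system_spec (sizes D t r) L U
  exact ⟨h1, fun hf => h2 hf.exists_isSolution⟩

/-- The solution of a record solves the system of the record. -/
def Record.Valid (D : Fin n → Fin k → ℝ) (L U : ℕ) (b : Record k) : Prop :=
  IsSolution (sizes D b.tuple b.radius) L U b.sol

theorem improve_spec (best : Option (Record k)) (new : Record k) :
    (∀ b ∈ (improve best new).val, b = new ∨ b ∈ best) ∧
      (∃ b ∈ (improve best new).val, b.radius ≤ new.radius) ∧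
      ∀ b ∈ best, ∃ b' ∈ (improve best new).val, b'.radius ≤ b.radius := by
  rcases best with _ | b
  · simp [improve]
  · by_cases h : new.radius < b.radius
    · simp [improve, h, h.le]
    · simp [improve, h, not_lt.1 h]

/-- A failed test excludes every radius up to the tested one, by monotonicity of `Feasible`. A
successful test leaves a record at least as good as all later radii. Monotonicity of the test itself
is not needed. The record may stem from another tuple, so the conclusion only bounds its radius. -/
theorem binarySearch_spec [NeZero k] (D : Fin n → Fin k → ℝ) (L U : ℕ) (R : List ℝ)
    (hR : R.Pairwise (· ≤ ·)) (t : Fin k → Fin k) (f lo hi : ℕ) (best : Option (Record k))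
    (hf : hi ≤ lo + f) (hhi : hi ≤ R.length) (hbest : ∀ b ∈ best, b.Valid D L U) :
    (∀ b ∈ (binarySearch D L U R t f lo hi best).val, b.Valid D L U) ∧
      (∀ b ∈ best, ∃ b' ∈ (binarySearch D L U R t f lo hi best).val, b'.radius ≤ b.radius) ∧
      ∀ i, lo ≤ i → i < hi → Feasible D L U t (R.getD i 0) →
        ∃ b' ∈ (binarySearch D L U R t f lo hi best).val, b'.radius ≤ R.getD i 0 := by
  have hself : ∀ b ∈ best, ∃ b' ∈ best, b'.radius ≤ b.radius := fun b hb => ⟨b, hb, le_rfl⟩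
  induction f generalizing lo hi best with
  | zero =>
    refine ⟨hbest, hself, fun i h1 h2 => ?_⟩
    omega
  | succ f ih =>
    simp only [binarySearch, bind_val, ops_val, decide_eq_true_eq, ite_val]
    split
    · refine ⟨hbest, hself, fun i h1 h2 => ?_⟩
      omega
    · rename_i hlt
      have hmono : ∀ i j, i ≤ j → j < R.length → R.getD i 0 ≤ R.getD j 0 := by
        intro i j hij hj
        rw [List.getD_eq_getElem _ _ (by omega), List.getD_eq_getElem _ _ hj]
        rcases hij.eq_or_lt with rfl | hij
        · exact le_rfl
        · exact List.pairwise_iff_getElem.1 hR i j _ _ hij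
      rw [nth_val]
      set mid := (lo + hi) / 2
      obtain ⟨h1, h2⟩ := testRadius_spec D L U t (R.getD mid 0)
      cases hs : (testRadius D L U t (R.getD mid 0)).val with
      | none =>
        obtain ⟨i1, i2, i3⟩ := ih (mid + 1) hi best (by omega) hhi hbest hself
        refine ⟨i1, i2, fun i hlo hi' hfeas => ?_⟩
        by_cases him : mid + 1 ≤ i
        · exact i3 i him hi' hfeas
        · obtain ⟨x, hx⟩ := h2 (hfeas.mono (hmono i mid (by omega) (by omega)))
          rw [hs] at hx
          cases hx
      | some x =>
        obtain ⟨j1, ⟨b, hb, hbr⟩, j3⟩ := improve_spec best ⟨R.getD mid 0, t, x⟩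
        obtain ⟨i1, i2, i3⟩ := ih lo mid (improve best ⟨R.getD mid 0, t, x⟩).val (by omega)
          (by omega) (fun b hb => by
            rcases j1 b hb with rfl | hb
            · exact h1 x hs
            · exact hbest b hb) fun b hb => ⟨b, hb, le_rfl⟩
        refine ⟨i1, fun b hb => ?_, fun i hlo hi' hfeas => ?_⟩
        · obtain ⟨b', hb', hr'⟩ := j3 b hb
          obtain ⟨b'', hb'', hr''⟩ := i2 b' hb'
          exact ⟨b'', hb'', hr''.trans hr'⟩
        · by_cases him : i < mid
          · exact i3 i hlo him hfeas
          · obtain ⟨b', hb', hr'⟩ := i2 b hb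
            exact ⟨b', hb', hr'.trans (hbr.trans (hmono mid i (by omega) (by omega)))⟩

theorem mem_tuples (m : ℕ) (t : Fin m → Fin k) : t ∈ (tuples k m).val := by
  induction m with
  | zero => simp [tuples, Subsingleton.elim t Fin.elim0]
  | succ m ih =>
    simp only [tuples, bind_val, forEach_val, tabulate_val, ops_val]
    rw [mem_foldl_iff fun j t => ∃ t' ∈ (tuples k m).val, t = Fin.cons j t']
    · exact Or.inr ⟨t 0, List.mem_finRange _, Fin.tail t, ih _, (Fin.cons_self_tail t).symm⟩
    · intro j _ b
      rw [mem_foldl_iff fun t' t => t = Fin.cons j t']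
      intro t' _ b
      rw [List.mem_cons, or_comm]

end

/-! ### Correctness of the algorithm -/

section

variable {n d k : ℕ}

/-- The list of all entries of the table `D`. -/
def entries (D : Fin n → Fin k → ℝ) : List ℝ :=
  (List.finRange n).foldl (fun acc i =>
    (List.finRange k).foldl (fun acc' j => D i j :: acc') acc) []

theorem mem_entries (D : Fin n → Fin k → ℝ) (i : Fin n) (j : Fin k) : D i j ∈ entries D := by
  rw [entries, mem_foldl_iff fun i x => ∃ j, x = D i j]
  · exact Or.inr ⟨i, List.mem_finRange i, j, rfl⟩
  · intro i _ b
    rw [mem_foldl_iff fun j x => x = D i j]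
    · simp
    · intro j _ b
      rw [List.mem_cons, or_comm]

theorem length_foldl_of_step {α γ : Type} {l : List α} {f : List γ → α → List γ} {b : List γ}
    {c : ℕ} (h : ∀ a b, (f b a).length = b.length + c) :
    (l.foldl f b).length = b.length + l.length * c := by
  induction l generalizing b with
  | nil => simp
  | cons a l ih => rw [List.foldl_cons, ih, h, List.length_cons]; ring

theorem length_entries (D : Fin n → Fin k → ℝ) : (entries D).length = n * k := by
  rw [entries, length_foldl_of_step (c := k)]
  · simp
  · intro i b
    rw [length_foldl_of_step (c := 1) fun _ _ => by simp]
    simp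

/-- The distances between the points and the points selected by Gonzalez's algorithm. -/
noncomputable def table (k : ℕ) (P : Fin n → EuclideanSpace ℝ (Fin d)) (i₀ : Fin n) (i : Fin n)
    (j : Fin k) : ℝ :=
  dist (P i) (P ((gonzalez k P i₀).val j))

/-- The sorted list of candidate radii. -/
noncomputable def radii (D : Fin n → Fin k → ℝ) : List ℝ :=
  (sort (entries D).length (entries D)).val

theorem length_radii (D : Fin n → Fin k → ℝ) : (radii D).length = n * k := by
  rw [radii, (sort_perm _ _).length_eq, length_entries]

/-- The record that the algorithm ends with. -/
noncomputable def bestRecord (D : Fin n → Fin k → ℝ) (L U : ℕ) : Option (Record k) :=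
  (tuples k k).val.foldl
    (fun best t => (binarySearch D L U (radii D) t (n * k) 0 (n * k) best).val) none

theorem algorithm_val [NeZero k] (P : Fin n → EuclideanSpace ℝ (Fin d)) (L U : ℕ) (i₀ : Fin n) :
    (algorithm k P L U i₀).val = (bestRecord (table k P i₀) L U).map fun b =>
      ⟨(distribute (allRegions (table k P i₀) b.tuple b.radius).val (roundSolution b.sol).val).val,
        fun j => (gonzalez k P i₀).val (b.tuple j), b.radius⟩ := by
  simp only [algorithm, bind_val, tabulate_val, distance_val, forEach_val, ops_val]
  change Timed.val (match bestRecord (table k P i₀) L U with | none => _ | some b => _) = _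
  rcases bestRecord (table k P i₀) L U with _ | b <;> rfl

/-- Each search meets the bound for its own tuple, and later searches never make the record worse.
-/
theorem bestRecord_spec [NeZero k] (D : Fin n → Fin k → ℝ) (L U : ℕ) :
    (∀ b ∈ bestRecord D L U, b.Valid D L U) ∧
      ∀ t r, r ∈ entries D → Feasible D L U t r → ∃ b ∈ bestRecord D L U, b.radius ≤ r := by
  have key := foldl_prefix_induction (l := (tuples k k).val) (b := (none : Option (Record k)))
    (f := fun best t => (binarySearch D L U (radii D) t (n * k) 0 (n * k) best).val)
    (fun l best => (∀ b ∈ best, b.Valid D L U) ∧ ∀ t ∈ l, ∀ i < n * k,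
      Feasible D L U t ((radii D).getD i 0) → ∃ b ∈ best, b.radius ≤ (radii D).getD i 0)
    (by simp) (by
      rintro l₁ t l₂ best - ⟨h1, h2⟩
      obtain ⟨i1, i2, i3⟩ := binarySearch_spec D L U (radii D) (sort_sorted _ _ le_rfl) t (n * k) 0
        (n * k) best (by omega) (length_radii D).ge h1
      refine ⟨i1, fun t' ht' i hi hfeas => ?_⟩
      rcases List.mem_append.1 ht' with ht' | ht'
      · obtain ⟨b, hb, hr⟩ := h2 t' ht' i hi hfeas
        obtain ⟨b', hb', hr'⟩ := i2 b hb
        exact ⟨b', hb', hr'.trans hr⟩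
      · obtain rfl := List.mem_singleton.1 ht'
        exact i3 i (Nat.zero_le _) hi hfeas)
  refine ⟨key.1, fun t r hr hfeas => ?_⟩
  obtain ⟨i, hi, rfl⟩ := List.getElem_of_mem ((sort_perm (entries D).length _).mem_iff.2 hr)
  have hi' : i < n * k := length_radii D ▸ hi
  have hget : (radii D).getD i 0 = (sort (entries D).length (entries D)).val[i] :=
    List.getD_eq_getElem _ _ hi
  rw [← hget] at hfeas ⊢
  exact key.2 t (mem_tuples k t) i hi' hfeas

/-- Some candidate radius is within four times the radius of any clustering. -/
theorem exists_feasible_entry (P : Fin n → EuclideanSpace ℝ (Fin d)) {L U : ℕ} (hL : 1 ≤ L)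
    (i₀ : Fin n) {a : Fin n → Fin k} {c : Fin k → EuclideanSpace ℝ (Fin d)} {r : ℝ}
    (h : IsBalancedClustering P L U a c r) :
    ∃ t, ∃ ρ ∈ entries (table k P i₀), Feasible (table k P i₀) L U t ρ ∧ ρ ≤ 4 * r := by
  obtain ⟨h1, h2⟩ := h
  -- The bound `1 ≤ L` makes every cluster nonempty, so that it has a representative `p j`.
  have hne : ∀ j, ∃ i, a i = j := fun j => by
    obtain ⟨i, hi⟩ := Finset.card_pos.1 (hL.trans (h1 j).1)
    exact ⟨i, by simpa using hi⟩
  choose p hp using hne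
  choose t ht using fun j => exists_dist_gonzalez_le P i₀ a c r h2 (p j)
  have hdist : ∀ i, table k P i₀ i (t (a i)) ≤ 4 * r := fun i => by
    have e1 := h2 i
    have e2 := h2 (p (a i))
    rw [hp] at e2
    have e3 := ht (a i)
    rw [table]
    -- From the point to its old center `r`, on to the representative `r`, and on to the selected
    -- point `2 * r`.
    linarith [dist_triangle (P i) (P (p (a i))) (P ((gonzalez k P i₀).val (t (a i)))),
      dist_triangle_right (P i) (P (p (a i))) (c (a i))]
  have : Nonempty (Fin n) := ⟨i₀⟩
  -- The candidate radius is the largest distance to a new center, hence an entry of the table.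
  obtain ⟨m, hm⟩ := Finite.exists_max fun i => table k P i₀ i (t (a i))
  exact ⟨t, _, mem_entries _ m (t (a m)), ⟨a, h1, hm⟩, hdist m⟩

/-- Assigning point `i` to cluster `i % k` gives clusters of `n / k` or `n / k + 1` points. The
infimum is thus taken over a nonempty set, and something is recorded. -/
theorem exists_isBalancedClustering [NeZero k] (P : Fin n → EuclideanSpace ℝ (Fin d)) {L U : ℕ}
    (i₀ : Fin n) (hL : L ≤ n / k) (hU : n ≤ U * k) :
    ∃ r, ∃ (a : Fin n → Fin k) (c : Fin k → EuclideanSpace ℝ (Fin d)),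
      IsBalancedClustering P L U a c r := by
  have hk : 0 < k := Nat.pos_of_ne_zero (NeZero.ne k)
  have : Nonempty (Fin n) := ⟨i₀⟩
  obtain ⟨m, hm⟩ := Finite.exists_max fun i => dist (P i) (P i₀)
  refine ⟨_, fun i => Fin.ofNat k i, fun _ => P i₀, fun j => ?_, hm⟩
  have hcard : (Finset.univ.filter fun i : Fin n => Fin.ofNat k i = j).card =
      n / k + if j % k < n % k then 1 else 0 := by
    rw [← Nat.count_modEq_card n hk j, Nat.count_eq_card_filter_range]
    rw [← Finset.card_map Fin.valEmbedding]
    congr 1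
    ext i
    simp only [Finset.mem_map, Finset.mem_filter, Finset.mem_univ, true_and,
      Fin.valEmbedding_apply, Finset.mem_range, Fin.ext_iff, Fin.val_ofNat, Nat.ModEq,
      Nat.mod_eq_of_lt j.isLt]
    constructor
    · rintro ⟨i, h, rfl⟩
      exact ⟨i.isLt, h⟩
    · rintro ⟨h1, h2⟩
      exact ⟨⟨i, h1⟩, h2, rfl⟩
  rw [hcard]
  refine ⟨by omega, ?_⟩
  have h1 : n / k ≤ U := Nat.div_le_of_le_mul (by rwa [mul_comm])
  split
  · rename_i hlt
    -- If `n / k` were already `U`, then `n ≤ U * k` would leave no remainder and no cluster would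
    -- be larger.
    rcases h1.eq_or_lt with h | h
    · have := Nat.div_add_mod n k
      rw [h, mul_comm] at this
      omega
    · omega
  · omega

theorem algorithm_correct [NeZero k] (P : Fin n → EuclideanSpace ℝ (Fin d)) {L U : ℕ}
    (i₀ : Fin n) (hL1 : 1 ≤ L) (hL : L ≤ n / k) (hU : n ≤ U * k) :
    ∃ out : Output n k, (algorithm k P L U i₀).val = some out ∧
      IsBalancedClustering P L U out.cluster (fun j => P (out.center j)) out.radius ∧
      out.radius ≤ 4 * optRadius k P L U := by
  obtain ⟨hvalid, hbest⟩ := bestRecord_spec (table k P i₀) L U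
  have hle : ∀ r, (∃ (a : Fin n → Fin k) (c : Fin k → EuclideanSpace ℝ (Fin d)),
      IsBalancedClustering P L U a c r) →
      ∃ b ∈ bestRecord (table k P i₀) L U, b.radius ≤ 4 * r := by
    rintro r ⟨a, c, h⟩
    obtain ⟨t, ρ, hρ, hfeas, hr⟩ := exists_feasible_entry P hL1 i₀ h
    obtain ⟨b, hb, hb'⟩ := hbest t ρ hρ hfeas
    exact ⟨b, hb, hb'.trans hr⟩
  have hex := exists_isBalancedClustering P i₀ hL hU
  obtain ⟨b, hb, -⟩ := hle _ hex.choose_spec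
  have hb' : bestRecord (table k P i₀) L U = some b := hb
  obtain ⟨h1, h2⟩ := round_distribute_spec (hvalid b hb)
  have hval := algorithm_val (k := k) P L U i₀
  rw [hb', Option.map_some] at hval
  generalize (distribute (allRegions (table k P i₀) b.tuple b.radius).val
    (roundSolution b.sol).val).val = a at h1 h2 hval
  refine ⟨_, hval, ⟨h2, h1⟩, ?_⟩
  -- The same record is compared with all clusterings, so the infimum need not be attained.
  have : b.radius / 4 ≤ optRadius k P L U := by
    refine le_csInf hex fun r hr => ?_
    obtain ⟨b', hb'', hr'⟩ := hle r hr
    obtain rfl : b = b' := Option.some.inj (hb'.symm.trans hb'')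
    linarith
  change b.radius ≤ _
  linarith

end

section

variable {n d k : ℕ}

/-! ### Running time of the linear programming part -/

theorem length_foldl_le_of_step {α γ : Type} {l : List α} {f : List γ → α → List γ} {b : List γ}
    {c : ℕ} (h : ∀ a b, (f b a).length ≤ b.length + c) :
    (l.foldl f b).length ≤ b.length + l.length * c := by
  induction l generalizing b with
  | nil => simp
  | cons a l ih =>
    rw [List.foldl_cons, List.length_cons]
    have h1 := h a b
    have h2 := ih (b := f b a)
    linarith

theorem row_time_le (isEq : Bool) (p : Var k → Prop) [DecidablePred p] (s b : ℚ) :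
    (row isEq p s b).time ≤ Fintype.card (Var k) * 4 + 1 := by
  simp only [row, bind_time, ops_time]
  exact Nat.add_le_add_right (tabulate_time_le (c := 3) fun _ => le_rfl) 1

theorem system_time_le (cnt : Region k → ℕ) (L U : ℕ) : (system cnt L U).time ≤
    ((regions k).length + k + (vars k).length) * (Fintype.card (Var k) * 8 + 6) := by
  simp only [system, bind_time]
  have h1 := forEach_time_le (l := regions k) (b := ([] : List (Constraint k)))
    (c := Fintype.card (Var k) * 8 + 5)
    (f := fun T acc => do
      let a ← row true (fun v => v.1 = T) 1 (cnt T)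
      ops 2 (a :: acc)) fun T _ _ => by
        have := row_time_le (k := k) true (fun v => v.1 = T) 1 (cnt T)
        simp only [bind_time, ops_time]
        omega
  have h2 := fun b => forEach_time_le (l := List.finRange k) (b := b)
    (c := Fintype.card (Var k) * 8 + 5)
    (f := fun j acc => do
      let a ← row false (fun v => v.2 = j) 1 U
      let b ← row false (fun v => v.2 = j) (-1) (-L)
      ops 3 (a :: b :: acc)) fun j _ _ => by
        have := row_time_le (k := k) false (fun v => v.2 = j) 1 U
        have := row_time_le (k := k) false (fun v => v.2 = j) (-1) (-L)
        simp only [bind_time, ops_time]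
        omega
  have h3 := fun b => forEach_time_le (l := vars k) (b := b)
    (c := Fintype.card (Var k) * 8 + 5)
    (f := fun v acc => do
      let a ← if v.2 ∈ v.1 then row false (fun w => w = v) (-1) 0
        else row true (fun w => w = v) 1 0
      ops 2 (a :: acc)) fun v _ _ => by
        have := row_time_le (k := k) false (fun w => w = v) (-1) 0
        have := row_time_le (k := k) true (fun w => w = v) 1 0
        split <;> simp only [bind_time, ops_time] <;> omega
  rw [List.length_finRange] at h2
  refine (add_le_add h1 (add_le_add (h2 _) (h3 _))).trans (le_of_eq ?_)
  ring

theorem length_system (cnt : Region k → ℕ) (L U : ℕ) :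
    (system cnt L U).val.length = (regions k).length + k * 2 + (vars k).length := by
  simp only [system, bind_val, forEach_val, ops_val]
  rw [length_foldl_of_step (c := 1) fun _ _ => by simp; split <;> simp,
    length_foldl_of_step (c := 2) fun _ _ => by simp,
    length_foldl_of_step (c := 1) fun _ _ => by simp]
  simp

theorem substitute_time_le (v : Var k) (e c : Constraint k) :
    (substitute v e c).time ≤ Fintype.card (Var k) * 5 + 9 := by
  simp only [substitute, bind_time, ops_time]
  have := tabulate_time_le (c := 4)
    (f := fun w => ops 4 (c.coef w - (ops 3 (c.coef v / e.coef v)).val * e.coef w)) fun _ => le_rfl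
  omega

theorem combine_time_le (v : Var k) (p q : Constraint k) :
    (combine v p q).time ≤ Fintype.card (Var k) * 9 + 9 := by
  simp only [combine, bind_time, ops_time]
  have := tabulate_time_le (c := 8)
    (f := fun w => ops 8 (-(q.coef v) * p.coef w + p.coef v * q.coef w)) fun _ => le_rfl
  omega

theorem select_time_le (v : Var k) (p : ℚ → Prop) [DecidablePred p] (cs : List (Constraint k)) :
    (select v p cs).time ≤ cs.length * 4 :=
  forEach_time_le (c := 3) fun _ _ _ => le_rfl

theorem length_select_le (v : Var k) (p : ℚ → Prop) [DecidablePred p] (cs : List (Constraint k)) :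
    (select v p cs).val.length ≤ cs.length := by
  simp only [select, forEach_val, ops_val]
  refine (length_foldl_le_of_step (c := 1) fun c b => ?_).trans (by simp)
  split <;> simp

theorem length_eliminate_le (v : Var k) (cs : List (Constraint k)) :
    (eliminate v cs).val.length ≤ cs.length + cs.length * cs.length := by
  simp only [eliminate, bind_val, forEach_val, ops_val]
  refine (length_foldl_le_of_step (c := cs.length) fun p b => ?_).trans ?_
  · refine (length_foldl_le_of_step (c := 1) fun q b => by simp).trans ?_
    rw [mul_one]
    exact Nat.add_le_add_left (length_select_le _ _ _) _
  · exact add_le_add (length_select_le _ _ _) (Nat.mul_le_mul_right _ (length_select_le _ _ _))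

theorem eliminate_time_le (v : Var k) (cs : List (Constraint k)) : (eliminate v cs).time ≤
    cs.length * 12 + cs.length * (cs.length * (Fintype.card (Var k) * 9 + 11) + 1) := by
  simp only [eliminate, bind_time]
  have h1 := select_time_le v (fun q => 0 < q) cs
  have h2 := select_time_le v (fun q => q < 0) cs
  have h3 := select_time_le v (fun q => q = 0) cs
  have h4 := fun b => forEach_time_le (l := (select v (fun q => 0 < q) cs).val) (b := b)
    (c := cs.length * (Fintype.card (Var k) * 9 + 11))
    (f := fun p acc => forEach (select v (fun q => q < 0) cs).val acc fun q acc' => do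
      let c ← combine v p q
      ops 1 (c :: acc')) fun p _ _ => by
        refine (forEach_time_le (c := Fintype.card (Var k) * 9 + 10) fun q _ _ => ?_).trans
          (Nat.mul_le_mul_right _ (length_select_le _ _ _))
        have := combine_time_le v p q
        simp only [bind_time, ops_time]
        omega
  have h5 := fun b => (h4 b).trans (Nat.mul_le_mul_right _ (length_select_le v _ cs))
  have h6 := h5 (select v (fun q => q = 0) cs).val
  omega

theorem bound_time_le (v : Var k) (x : Var k → ℚ) (c : Constraint k) :
    (bound v x c).time ≤ (vars k).length * 7 + 2 := by
  simp only [bound, bind_time, ops_time]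
  exact Nat.add_le_add_right (forEach_time_le (c := 6) fun _ _ _ => le_rfl) 2

theorem chooseValue_time_le (v : Var k) (cs : List (Constraint k)) (x : Var k → ℚ) :
    (chooseValue v cs x).time ≤
      cs.length * 8 + 2 * (cs.length * ((vars k).length * 7 + 5)) + 2 := by
  have h1 := select_time_le v (fun q => 0 < q) cs
  have h2 := select_time_le v (fun q => q < 0) cs
  have h3 : ∀ (m : ℚ → ℚ → ℚ) (p : ℚ → Prop) [DecidablePred p],
      (forEach (select v p cs).val none fun c acc => do
        let b ← bound v x c
        ops 2 (some (acc.elim b (m b)))).time ≤ cs.length * ((vars k).length * 7 + 5) := by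
    intro m p _
    refine (forEach_time_le (c := (vars k).length * 7 + 4) fun c _ _ => ?_).trans
      (Nat.mul_le_mul_right _ (length_select_le _ _ _))
    have := bound_time_le v x c
    simp only [bind_time, ops_time]
    omega
  have h4 := h3 max (fun q => q < 0)
  have h5 := h3 min (fun q => 0 < q)
  simp only [chooseValue, bind_time]
  split
  · simp only [ops_time]
    omega
  · simp only [bind_time, ops_time]
    omega

/-- The time of `solve` is bounded in terms of the number of constraints. -/
theorem exists_solve_time_le (vs : List (Var k)) (N : ℕ) :
    ∃ C, ∀ cs : List (Constraint k), cs.length ≤ N → (solve vs cs).time ≤ C := by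
  induction vs generalizing N with
  | nil =>
    refine ⟨N * 6 + Fintype.card (Var k) * 2 + 1, fun cs h => ?_⟩
    have h1 := (forEach_time_le (l := cs) (b := true) (c := 5) (f := fun c acc =>
      ops 5 (acc && (if c.isEq then decide (c.rhs = 0) else decide (0 ≤ c.rhs))))
      fun _ _ _ => le_rfl).trans (Nat.mul_le_mul_right _ h)
    have h2 := tabulate_time_le (c := 1) (f := fun _ : Var k => ops 1 (0 : ℚ)) fun _ => le_rfl
    simp only [solve, bind_time, ops_time]
    omega
  | cons v vs ih =>
    obtain ⟨C₁, hC₁⟩ := ih N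
    -- A substitution keeps the number of constraints, whereas an elimination may add one for every
    -- pair. The induction therefore has to allow any `N`.
    obtain ⟨C₂, hC₂⟩ := ih (N + N * N)
    refine ⟨N * 5 + 1 + N * (Fintype.card (Var k) * 5 + 11) + C₁ + ((vars k).length * 7 + 2) + 1 +
      (N * 12 + N * (N * (Fintype.card (Var k) * 9 + 11) + 1)) + C₂ +
      (N * 8 + 2 * (N * ((vars k).length * 7 + 5)) + 2), fun cs h => ?_⟩
    have hfind := (findFirst_time_le (c := 4) (l := cs)
      (p := fun c => ops 4 (c.isEq && decide (c.coef v ≠ 0))) fun _ _ => le_rfl).trans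
      (Nat.add_le_add_right (Nat.mul_le_mul_right _ h) 1)
    simp only [solve, bind_time]
    split
    · rename_i e _
      have h1 : (forEach cs [] fun c acc => do
          let c' ← substitute v e c
          ops 1 (c' :: acc)).time ≤ N * (Fintype.card (Var k) * 5 + 11) :=
        (forEach_time_le (c := Fintype.card (Var k) * 5 + 10) fun c _ _ => by
          have := substitute_time_le v e c
          simp only [bind_time, ops_time]
          omega).trans (Nat.mul_le_mul_right _ h)
      have h2 := hC₁ (forEach cs [] fun c acc => do
          let c' ← substitute v e c
          ops 1 (c' :: acc)).val (by
            rw [forEach_val, length_foldl_of_step (c := 1) fun _ _ => by simp]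
            simpa using h)
      simp only [bind_time]
      split
      · simp only [ops_time]
        omega
      · rename_i x _
        have h3 := bound_time_le v x e
        simp only [bind_time, ops_time]
        omega
    · have h1 : (eliminate v cs).time ≤
          N * 12 + N * (N * (Fintype.card (Var k) * 9 + 11) + 1) :=
        (eliminate_time_le v cs).trans (by gcongr)
      have h2 := hC₂ (eliminate v cs).val
        ((length_eliminate_le v cs).trans (by gcongr))
      simp only [bind_time]
      split
      · simp only [ops_time]
        omega
      · rename_i x _
        have h3 : (chooseValue v cs x).time ≤
            N * 8 + 2 * (N * ((vars k).length * 7 + 5)) + 2 :=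
          (chooseValue_time_le v cs x).trans (by gcongr)
        simp only [bind_time, ops_time]
        omega

theorem regionOf_time_le (D : Fin n → Fin k → ℝ) (t : Fin k → Fin k) (r : ℝ) (i : Fin n) :
    (regionOf D t r i).time ≤ k * 6 := by
  have := forEach_time_le (l := List.finRange k) (b := (∅ : Region k)) (c := 5)
    (f := fun j T => ops 5 (if D i (t j) ≤ r then insert j T else T)) fun _ _ _ => le_rfl
  simpa [regionOf] using this

theorem allRegions_time_le (D : Fin n → Fin k → ℝ) (t : Fin k → Fin k) (r : ℝ) :
    (allRegions D t r).time ≤ n * (k * 6 + 1) := by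
  simpa [allRegions] using tabulate_time_le (f := fun i => regionOf D t r i) fun i =>
    regionOf_time_le D t r i

theorem countIn_time_le (reg : Fin n → Region k) (T : Region k) :
    (countIn reg T).time ≤ n * 4 := by
  have := forEach_time_le (l := List.finRange n) (b := 0) (c := 3)
    (f := fun i c => ops 3 (if reg i = T then c + 1 else c)) fun _ _ _ => le_rfl
  simpa [countIn] using this

/-- The number of constraints and of variables depends on `k` only. The points enter just through
finding and counting their regions. -/
theorem exists_testRadius_time_le (k : ℕ) : ∃ C, ∀ (n : ℕ) (D : Fin n → Fin k → ℝ) (L U : ℕ)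
    (t : Fin k → Fin k) (r : ℝ), (testRadius D L U t r).time ≤ C * n + C := by
  obtain ⟨C, hC⟩ := exists_solve_time_le (vars k)
    ((regions k).length + k * 2 + (vars k).length)
  set S := ((regions k).length + k + (vars k).length) * (Fintype.card (Var k) * 8 + 6)
  set M := Fintype.card (Region k)
  refine ⟨C + S + (k * 6 + 1) + M * 4 + M, fun n D L U t r => ?_⟩
  have h1 := allRegions_time_le D t r
  have h2 : _ ≤ M * (n * 4 + 1) := tabulate_time_le
    (f := fun T => countIn (allRegions D t r).val T) fun T => countIn_time_le _ T
  have h3 : _ ≤ S := system_time_le (tabulate fun T => countIn (allRegions D t r).val T).val L U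
  have h4 := hC (system (tabulate fun T => countIn (allRegions D t r).val T).val L U).val
    (length_system _ _ _).le
  simp only [testRadius, bind_time]
  refine (add_le_add h1 (add_le_add h2 (add_le_add h3 h4))).trans ?_
  ring_nf
  nlinarith [Nat.zero_le (C * n), Nat.zero_le (S * n), Nat.zero_le (M * n)]

/-! ### Running time of the rounding part -/

theorem fracDegree_time_le (x : Var k → ℚ) (j : Fin k) :
    (fracDegree x j).time ≤ (regions k).length * 6 :=
  forEach_time_le (c := 5) fun _ _ _ => le_rfl

theorem cut_time_le (j : Fin k) (es : List (Edge k)) : (cut j es).time ≤ es.length * 3 + 1 := by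
  induction es with
  | nil => simp [cut]
  | cons e es ih =>
    simp only [cut, bind_time, ops_time, ite_time, List.length_cons]
    split <;> omega

theorem length_cut_le (j : Fin k) (es : List (Edge k)) :
    (cut j es).val.length ≤ es.length := by
  induction es with
  | nil => simp [cut]
  | cons e es ih =>
    rw [cut_val_cons]
    split <;> simp [ih]

/-- The term `N * 9` pays for three passes over the trail: looking up the colour, looking up the
next ball, and cutting. -/
theorem walk_time_le (x : Var k → ℚ) (N f : ℕ) (trail : List (Edge k)) (v : Fin k)
    (h : f + trail.length ≤ N) : (walk x f trail v).time ≤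
      f * ((regions k).length * 8 + k * 6 + N * 9 + 10) ∧
      (walk x f trail v).val.length ≤ N + 1 := by
  induction f generalizing trail v with
  | zero => simp only [walk, pure_time, pure_val]; omega
  | succ f ih =>
    have e1 : ∀ c : Region k → Bool, (findFirst (fun T => do
        let b ← isFrac x T v
        ops 4 (b && c T)) (regions k)).time ≤ (regions k).length * 8 + 1 := fun c =>
      findFirst_time_le (c := 7) fun _ _ => le_rfl
    have e2 : ∀ c : Edge k → Bool, (findFirst (fun e => ops 2 (c e)) trail).time ≤ N * 3 + 1 :=
      fun c => (findFirst_time_le (c := 2) fun _ _ => le_rfl).trans (by omega)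
    have e3 : ∀ T, (findFirst (fun w => do
        let b ← isFrac x T w
        ops 2 (b && decide (w ≠ v))) (List.finRange k)).time ≤ k * 6 + 1 := fun T => by
      simpa using findFirst_time_le (l := List.finRange k) (c := 5) (p := fun w => do
        let b ← isFrac x T w
        ops 2 (b && decide (w ≠ v))) fun _ _ => le_rfl
    have e4 := e1 fun T => decide (trail.head?.map Edge.region ≠ some T)
    rw [Nat.succ_mul]
    simp only [walk, bind_time, bind_val]
    split
    · simp only [ops_time, ops_val]
      omega
    · rename_i T _
      have e5 := e2 fun e => decide (e.region = T)
      have e6 := e3 T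
      -- The rest of the step is bounded for an arbitrary next ball, since this ball comes from
      -- either of two searches.
      have hw : ∀ w? : Option (Fin k), (match w? with
          | none => ops 1 trail
          | some w => do
            let back ← findFirst (fun e : Edge k => ops 2 (decide (e.src = w))) trail
            match back with
            | some _ => do
              let c ← cut w trail
              ops 2 (⟨v, T, w⟩ :: c)
            | none => do
              let trail' ← ops 2 (⟨v, T, w⟩ :: trail)
              walk x f trail' w : Timed (List (Edge k))).time ≤ (N * 3 + 1) + (N * 3 + 3) +
                f * ((regions k).length * 8 + k * 6 + N * 9 + 10) ∧ (match w? with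
          | none => ops 1 trail
          | some w => do
            let back ← findFirst (fun e : Edge k => ops 2 (decide (e.src = w))) trail
            match back with
            | some _ => do
              let c ← cut w trail
              ops 2 (⟨v, T, w⟩ :: c)
            | none => do
              let trail' ← ops 2 (⟨v, T, w⟩ :: trail)
              walk x f trail' w : Timed (List (Edge k))).val.length ≤ N + 1 := by
        rintro (_ | w)
        · simp only [ops_time, ops_val]
          omega
        · have e7 := e2 fun e => decide (e.src = w)
          simp only [bind_time, bind_val]
          split
          · have e8 := cut_time_le w trail
            have e9 := length_cut_le w trail
            simp only [bind_time, bind_val, ops_time, ops_val, List.length_cons]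
            omega
          · obtain ⟨i1, i2⟩ := ih (⟨v, T, w⟩ :: trail) w (by simp only [List.length_cons]; omega)
            simp only [bind_time, bind_val, ops_time, ops_val]
            omega
      simp only [bind_time, bind_val]
      split
      · rename_i e _
        have e7 := hw (some e.dst)
        simp only [bind_time, bind_val]
        refine ⟨(add_le_add e4 (add_le_add e5 (add_le_add (le_refl 2) e7.1))).trans ?_, e7.2⟩
        omega
      · have e7 := hw (findFirst (fun w => do
          let b ← isFrac x T w
          ops 2 (b && decide (w ≠ v))) (List.finRange k)).val
        simp only [bind_time, bind_val]
        refine ⟨(add_le_add e4 (add_le_add e5 (add_le_add e6 e7.1))).trans ?_, e7.2⟩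
        omega

theorem adjust_time_le (x : Var k → ℚ) (es : List (Edge k)) :
    (adjust x es).time ≤ es.length * 20 := by
  simp only [adjust, bind_time]
  have h1 := forEach_time_le (l := es) (b := (1 : ℚ)) (c := 10) (f := fun e acc =>
    ops 10 (min acc (min (x (e.region, e.src) - ⌊x (e.region, e.src)⌋)
      (⌈x (e.region, e.dst)⌉ - x (e.region, e.dst))))) fun _ _ _ => le_rfl
  have h2 := fun δ : ℚ => forEach_time_le (l := es) (b := x) (c := 8) (f := fun e y => do
    let y' ← ops 4 (Function.update y (e.region, e.src) (y (e.region, e.src) - δ))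
    ops 4 (Function.update y' (e.region, e.dst) (y' (e.region, e.dst) + δ))) fun _ _ _ => le_rfl
  refine (add_le_add h1 (h2 _)).trans (le_of_eq ?_)
  ring

theorem exists_roundStep_time_le (k : ℕ) :
    ∃ C, ∀ x : Var k → ℚ, (roundStep x).time ≤ C := by
  refine ⟨2 * (k * ((regions k).length * 6 + 2) + 1) + 1 +
    (k + 1) * ((regions k).length * 8 + k * 6 + (k + 1) * 9 + 10) + (k + 2) * 20, fun x => ?_⟩
  have h1 : ∀ c : ℕ → Bool, (findFirst (fun j => do
      let b ← fracDegree x j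
      ops 1 (c b)) (List.finRange k)).time ≤ k * ((regions k).length * 6 + 2) + 1 := fun c => by
    simpa using findFirst_time_le (l := List.finRange k) (c := (regions k).length * 6 + 1)
      (p := fun j => do
        let b ← fracDegree x j
        ops 1 (c b)) fun j _ => by
          have := fracDegree_time_le x j
          simp only [bind_time, ops_time]
          omega
  have h2 := h1 fun c => decide (c = 1)
  have h3 := h1 fun c => decide (0 < c)
  have h4 : ∀ j, (walk x (k + 1) [] j).time + (adjust x (walk x (k + 1) [] j).val).time ≤
      (k + 1) * ((regions k).length * 8 + k * 6 + (k + 1) * 9 + 10) + (k + 2) * 20 := fun j => by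
    obtain ⟨i1, i2⟩ := walk_time_le x (k + 1) (k + 1) [] j (by simp)
    exact add_le_add i1 ((adjust_time_le _ _).trans (Nat.mul_le_mul_right _ i2))
  have h5 : ∀ start : Option (Fin k), (match start with
        | none => ops 1 x
        | some j => do
          let es ← walk x (k + 1) [] j
          adjust x es : Timed (Var k → ℚ)).time ≤
            (k + 1) * ((regions k).length * 8 + k * 6 + (k + 1) * 9 + 10) + (k + 2) * 20 := by
    rintro (_ | j)
    · simp only [ops_time]
      omega
    · exact h4 j
  simp only [roundStep, bind_time]
  split
  · rename_i j _
    refine (add_le_add h2 (add_le_add (le_refl 1) (h5 (some j)))).trans ?_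
    omega
  · refine (add_le_add h2 (add_le_add h3 (h5 (findFirst (fun j => do
      let c ← fracDegree x j
      ops 1 (decide (0 < c))) (List.finRange k)).val))).trans ?_
    omega

theorem exists_roundSolution_time_le (k : ℕ) :
    ∃ C, ∀ x : Var k → ℚ, (roundSolution x).time ≤ C := by
  obtain ⟨C, hC⟩ := exists_roundStep_time_le k
  exact ⟨(vars k).length * (C + 1), fun x => forEach_time_le fun _ _ y => hC y⟩

theorem distribute_time_le [NeZero k] (reg : Fin n → Region k) (x : Var k → ℚ) :
    (distribute reg x).time ≤ Fintype.card (Var k) * 3 + n * 2 + n * (k * 4 + 7) := by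
  have h1 := tabulate_time_le (c := 2) (f := fun v : Var k => ops 2 ⌊x v⌋₊) fun _ => le_rfl
  have h2 := tabulate_time_le (c := 1) (f := fun _ : Fin n => ops 1 (0 : Fin k)) fun _ => le_rfl
  have h3 : ∀ b, (forEach (List.finRange n) b
    (fun i (st : (Var k → ℕ) × (Fin n → Fin k)) => do
      let j? ← findFirst (fun j => ops 3 (decide (0 < st.1 (reg i, j)))) (List.finRange k)
      match j? with
      | none => ops 1 st
      | some j => ops 5 (Function.update st.1 (reg i, j) (st.1 (reg i, j) - 1),
          Function.update st.2 i j))).time ≤ (List.finRange n).length * (k * 4 + 7) := fun b =>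
      forEach_time_le (c := k * 4 + 6) fun i _ st => by
        have := findFirst_time_le (l := List.finRange k) (c := 3)
          (p := fun j => ops 3 (decide (0 < st.1 (reg i, j)))) fun _ _ => le_rfl
        rw [List.length_finRange] at this
        simp only [bind_time]
        split <;> simp only [ops_time] <;> omega
  simp only [distribute, bind_time, pure_time]
  rw [Fintype.card_fin] at h2
  rw [List.length_finRange] at h3
  exact (add_le_add h1 (add_le_add h2 (h3 _))).trans (by omega)

/-! ### Running time of the algorithm -/

theorem improve_time_le (best : Option (Record k)) (new : Record k) :
    (improve best new).time ≤ 4 := by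
  rcases best with _ | b <;> simp [improve]

/-- Fewer than `2 ^ m` positions remain, and each test halves this bound. A round costs at most
`R.length + 1` for reaching the entry of the linked list, `c` for the test, and `7` for the rest. -/
theorem binarySearch_time_le (D : Fin n → Fin k → ℝ) (L U : ℕ) (R : List ℝ) (t : Fin k → Fin k)
    (c : ℕ) (hc : ∀ r, (testRadius D L U t r).time ≤ c) (f lo hi : ℕ) (best : Option (Record k))
    (m : ℕ) (hm : hi < lo + 2 ^ m) :
    (binarySearch D L U R t f lo hi best).time ≤ m * (R.length + c + 8) + 2 := by
  induction f generalizing lo hi best m with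
  | zero => simp [binarySearch]
  | succ f ih =>
    simp only [binarySearch, bind_time, ops_time, ops_val, decide_eq_true_eq, ite_time]
    split
    · omega
    · rename_i hlt
      obtain ⟨m, rfl⟩ : ∃ m', m = m' + 1 := by
        rcases m with _ | m
        · simp at hm; omega
        · exact ⟨m, rfl⟩
      rw [pow_succ] at hm
      have h1 := nth_time_le R ((lo + hi) / 2)
      have h2 := hc (nth R ((lo + hi) / 2)).val
      rw [Nat.succ_mul]
      split
      · have h3 := ih ((lo + hi) / 2 + 1) hi best m (by omega)
        simp only [bind_time, ops_time, ops_val]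
        omega
      · rename_i x _
        have h3 := improve_time_le best ⟨(nth R ((lo + hi) / 2)).val, t, x⟩
        have h4 := ih lo ((lo + hi) / 2)
          (improve best ⟨(nth R ((lo + hi) / 2)).val, t, x⟩).val m (by omega)
        simp only [bind_time]
        omega

end

section

variable {n d k : ℕ}

theorem table_time_le (P : Fin n → EuclideanSpace ℝ (Fin d)) (s : Fin k → Fin n) :
    (tabulate fun i : Fin n => tabulate fun j : Fin k => distance (P i) (P (s j))).time ≤
      n * (k * (9 * d + 2) + 1) := by
  simpa using tabulate_time_le
    (f := fun i : Fin n => tabulate fun j : Fin k => distance (P i) (P (s j))) fun i =>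
      tabulate_time_le fun j => distance_time_le (P i) (P (s j))

theorem entries_time_le (D : Fin n → Fin k → ℝ) :
    (forEach (List.finRange n) [] fun i acc =>
      forEach (List.finRange k) acc fun j acc' => ops 2 (D i j :: acc')).time ≤
      n * (k * 3 + 1) := by
  have := forEach_time_le (l := List.finRange n) (b := []) (c := (List.finRange k).length * 3)
    (f := fun i acc => forEach (List.finRange k) acc fun j acc' => ops 2 (D i j :: acc'))
    fun _ _ _ => forEach_time_le (c := 2) fun _ _ _ => le_rfl
  simpa using this

theorem exists_algorithm_time_le (k : ℕ) [NeZero k] : ∃ C, ∀ (n d : ℕ)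
    (P : Fin n → EuclideanSpace ℝ (Fin d)) (L U : ℕ) (i₀ : Fin n), 1 ≤ d →
      (algorithm k P L U i₀).time ≤ C * (n * (Nat.log 2 n + d)) := by
  obtain ⟨C, hC⟩ := exists_testRadius_time_le k
  obtain ⟨ρ, hρ⟩ := exists_roundSolution_time_le k
  set τ := (tuples k k).val.length
  set τ' := (tuples k k).time
  set V := Fintype.card (Var k)
  refine ⟨(7 * k + 3 + τ' + 3 * τ + ρ + 3 * V) + (34 * k + 14) + (18 * k + 9) +
    (τ * (C + 8) + (9 * k + τ * (k + C))) * (k + 2), fun n d P L U i₀ hd => ?_⟩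
  -- Chosen such that `n * k < 2 ^ m`, from `n < 2 ^ (Nat.log 2 n + 1)` and `k < 2 ^ k`.
  set m := Nat.log 2 n + 1 + k with hm
  have hn : 1 ≤ n := i₀.pos
  have hnk : n * k < 2 ^ m := by
    rw [hm, pow_add]
    exact Nat.mul_lt_mul'' (Nat.lt_pow_succ_log_self (by norm_num) n) (Nat.lt_two_pow_self)
  have hlen : (radii (table k P i₀)).length = n * k := length_radii _
  have h1 := gonzalez_time_le (k := k) P i₀
  have h2 := table_time_le P (gonzalez k P i₀).val
  have h3 := entries_time_le (table k P i₀)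
  have h4 : (sort (entries (table k P i₀)).length (entries (table k P i₀))).time ≤
      9 * (n * k) * (m + 1) + 1 :=
    (sort_time_le _ _ m (by rw [length_entries]; exact hnk.le)).trans_eq (by rw [length_entries])
  have h5 : (forEach (tuples k k).val none fun t best =>
      binarySearch (table k P i₀) L U (radii (table k P i₀)) t (n * k) 0 (n * k) best).time ≤
      τ * (m * (n * k + (C * n + C) + 8) + 2 + 1) :=
    forEach_time_le fun t _ best => by
      have := binarySearch_time_le (table k P i₀) L U (radii (table k P i₀)) t (C * n + C)
        (fun r => hC n _ L U t r) (n * k) 0 (n * k) best m (by omega)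
      rwa [hlen] at this
  have h6 : ∀ best : Option (Record k), (match best with
      | none => ops 1 none
      | some b => do
        let x ← roundSolution b.sol
        let reg ← allRegions (table k P i₀) b.tuple b.radius
        let a ← distribute reg x
        let c ← tabulate fun j => ops 2 ((gonzalez k P i₀).val (b.tuple j))
        ops 1 (some ⟨a, c, b.radius⟩) : Timed (Option (Output n k))).time ≤
      ρ + (n * (k * 6 + 1) + ((V * 3 + n * 2 + n * (k * 4 + 7)) + (k * 3 + 1))) := by
    rintro (_ | b)
    · simp only [ops_time]
      omega
    · have e1 := hρ b.sol
      have e2 := allRegions_time_le (table k P i₀) b.tuple b.radius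
      have e3 := distribute_time_le (allRegions (table k P i₀) b.tuple b.radius).val
        (roundSolution b.sol).val
      have e4 := tabulate_time_le (c := 2)
        (f := fun j => ops 2 ((gonzalez k P i₀).val (b.tuple j))) fun _ => le_rfl
      rw [Fintype.card_fin] at e4
      simp only [bind_time, ops_time]
      exact add_le_add e1 (add_le_add e2 (add_le_add e3 (add_le_add e4 le_rfl)))
  have htotal : (algorithm k P L U i₀).time ≤
      (2 * k + n * (9 * d + 2) + k * (5 * n + n * (9 * d + 5) + 2)) +
      (n * (k * (9 * d + 2) + 1) + (n * (k * 3 + 1) + ((9 * (n * k) * (m + 1) + 1) +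
      (τ' + (1 + (τ * (m * (n * k + (C * n + C) + 8) + 2 + 1) +
      (ρ + (n * (k * 6 + 1) + ((V * 3 + n * 2 + n * (k * 4 + 7)) + (k * 3 + 1)))))))))) := by
    have hD : (tabulate fun i : Fin n => tabulate fun j : Fin k =>
        distance (P i) (P ((gonzalez k P i₀).val j))).val = table k P i₀ := by
      simp only [tabulate_val, distance_val]
      rfl
    have hl : (forEach (List.finRange n) [] fun i acc => forEach (List.finRange k) acc
        fun j acc' => ops 2 (table k P i₀ i j :: acc')).val = entries (table k P i₀) := by
      simp only [forEach_val, ops_val]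
      rfl
    simp only [algorithm, bind_time, hD, hl, ops_time, ops_val]
    exact add_le_add h1 (add_le_add h2 (add_le_add h3 (add_le_add h4 (add_le_add le_rfl
      (add_le_add le_rfl (add_le_add h5 (h6 _)))))))
  set E := n * (Nat.log 2 n + d) with hE
  -- Here `1 ≤ d` matters: for `n = 1` the logarithm vanishes.
  have b1 : n ≤ E := Nat.le_mul_of_pos_right _ (by omega)
  have b2 : n * d ≤ E := Nat.mul_le_mul_left _ (by omega)
  have b3 : n * m ≤ (k + 2) * E := by
    rw [hE, mul_left_comm]
    refine Nat.mul_le_mul_left _ ?_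
    rw [hm]
    nlinarith
  have b4 : m ≤ (k + 2) * E := (Nat.le_mul_of_pos_left _ hn).trans b3
  have b5 : 1 ≤ E := hn.trans b1
  refine htotal.trans ?_
  calc _ = (7 * k + 3 + τ' + 3 * τ + ρ + 3 * V) * 1 + (34 * k + 14) * n + (18 * k + 9) * (n * d) +
        (τ * (C + 8) * m + (9 * k + τ * (k + C)) * (n * m)) := by ring
    _ ≤ (7 * k + 3 + τ' + 3 * τ + ρ + 3 * V) * E + (34 * k + 14) * E + (18 * k + 9) * E +
        (τ * (C + 8) * ((k + 2) * E) + (9 * k + τ * (k + C)) * ((k + 2) * E)) := by gcongr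
    _ = _ := by ring

end

end BalancedKCenter

/-! ### The main theorem -/

theorem theorem1 (k : ℕ) [NeZero k] :
    ∃ C : ℝ, ∀ (n d : ℕ) (P : Fin n → EuclideanSpace ℝ (Fin d)) (L U : ℕ) (i₀ : Fin n),
      1 ≤ d → 1 ≤ L → L ≤ ⌊(n : ℝ) / k⌋₊ → ⌈(n : ℝ) / k⌉₊ ≤ U → U ≤ n →
      (∃ out : BalancedKCenter.Output n k,
        (BalancedKCenter.algorithm k P L U i₀).val = some out ∧
        BalancedKCenter.IsBalancedClustering P L U out.cluster (fun j => P (out.center j))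
          out.radius ∧
        out.radius ≤ 4 * BalancedKCenter.optRadius k P L U) ∧
      ((BalancedKCenter.algorithm k P L U i₀).time : ℝ) ≤ C * (n * (Real.log n + d)) := by
  obtain ⟨C, hC⟩ := BalancedKCenter.exists_algorithm_time_le k
  -- The factor `2` pays for the change from binary to natural logarithms, as `Real.log 2 > 1 / 2`.
  refine ⟨C * 2, fun n d P L U i₀ hd hL1 hL hU _ => ⟨?_, ?_⟩⟩
  · have hk : (0 : ℝ) < k := by exact_mod_cast Nat.pos_of_ne_zero (NeZero.ne k)
    refine BalancedKCenter.algorithm_correct P i₀ hL1 (by rwa [Nat.floor_div_eq_div] at hL) ?_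
    have := (div_le_iff₀ hk).1 (Nat.ceil_le.1 hU)
    exact_mod_cast this
  · have hn : (1 : ℝ) ≤ n := by exact_mod_cast i₀.pos
    have hlog : (Nat.log 2 n : ℝ) ≤ 2 * Real.log n := by
      refine (Real.natLog_le_logb n 2).trans ?_
      rw [Real.logb, div_le_iff₀ (Real.log_pos (by norm_num))]
      have h0 := Real.log_nonneg hn
      have h2 := Real.log_two_gt_d9
      push_cast
      nlinarith
    calc ((BalancedKCenter.algorithm k P L U i₀).time : ℝ)
        ≤ (C * (n * (Nat.log 2 n + d)) : ℕ) := by exact_mod_cast hC n d P L U i₀ hd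
      _ = C * (n * (Nat.log 2 n + d)) := by push_cast; ring
      _ ≤ C * (n * (2 * Real.log n + 2 * d)) := by
        gcongr; linarith [(Nat.cast_nonneg d : (0 : ℝ) ≤ d)]
      _ = C * 2 * (n * (Real.log n + d)) := by ring
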